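/- Let $Q\in\mathbb N$, $1\le\tau\le \frac{Q}{2e^{3/2}\pi}$, $\mathbf r=(r_1,\dots,r_Q)$ with all $r_j>0$, and $I_{\mathbf r}=\prod_{j=1}^Q[-r_j,r_j]$. Let $p_0=1$ and $p_k(\cos\theta)=\sqrt2\cos(k\theta)$ for $k\ge1$. For $\mathbf k\in\mathbb Z_{\ge0}^Q$ put $p_{\mathbf k,\mathbf r}(\mathbf x)=\prod_{j}p_{k_j}(x_j/r_j)$ and $v_{\mathbf r}(\mathbf x)=\pi^{-Q}\prod_j(r_j^2-x_j^2)^{-1/2}$; for a real function $F$ on $I_{\mathbf r}$ put $$S_N(F)=\sum_{|\mathbf k|_1=N}\Big(\int_{I_{\mathbf r}}F\,p_{\mathbf k,\mathbf r}\,v_{\mathbf r}\,d\mathbf x\Big)\,p_{\mathbf k,\mathbf r},\qquad N=0,1,2,\dots .$$ Let $\Lambda(N)=\left(\frac{2\pi}{Q}\right)^{Q/2}N^{Q/2}\frac{\tau^N}{N!}$ (so $\Lambda(0)=0$), and let $\mathcal B_Q$ be the set of all $F\in L_\infty(I_{\mathbf r})$ (real-valued, functions equal almost everywhere being identified) with $\|S_N(F)\|_{L_\infty(I_{\mathbf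 r})}\le\Lambda(N)$ for all $N\ge0$. For compact $K\subset L_\infty(I_{\mathbf r})$ and $\epsilon>0$ let $H_\epsilon(K)$ be the natural logarithm of the least $n$ for which there are $n$ points of $L_\infty(I_{\mathbf r})$ such that each element of $K$ is at distance at most $\epsilon$ from one of them. Then $\mathcal B_Q$ is compact in $L_\infty(I_{\mathbf r})$, and the following hold, where $D(B)=\dfrac{B}{\log B-\log(e\tau)}$. (a) If $0<\epsilon\le\left(\frac{2\pi e\tau}{Q}\right)^{Q/2}\frac{4}{(e\tau)^{1/2}\exp(e^2\tau)}$ and $B_+=\log\frac4\epsilon+\frac Q2\log\frac{2e\pi\tau}{Q}$, then $$H_\epsilon(\mathcal B_Q)\le\frac{2}{3\sqrt{2\pi}}\left(\frac{2e}{Q}\right)^Q\left(D(B_+)+\frac{3Q}{4}\right)^{Q+1}\left(5\log\log\frac1\epsilon+\log\left((Q+1)^2(e\tau)^6\right)\right).$$ (b) Let $a=\max\{3e^2\tau,128\}$ and $\xi_\tau=\frac{16\,a\log a}{e}+2$. If $0<\epsilon\le\left(\frac{2\pi}{Q}\right)^{Q/2}\frac{1}{4\sqrt{2\pi e\tau}}\,\xi_\tau^{-2\xi_\tau}$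 and $B_-=\log\frac{1}{4\sqrt{2\pi e\tau}\,\epsilon}+\frac Q2\log\frac{2\pi}{Q}$, then $$H_\epsilon(\mathcal B_Q)\ge\frac{1}{16\sqrt{\pi Q}}\left(\frac1Q\right)^Q\left(D(B_-)-\frac52+Q\right)^Q\left(D(B_-)-\frac32\right).$$ (c) There are functions $\delta_1,\delta_2$ of $\epsilon$, each asymptotically equivalent to $\dfrac{Q\log\log(1/\epsilon)}{\log(1/\epsilon)}$ as $\epsilon\to0^+$ (in particular $\delta_i(\epsilon)=o(1)$), such that for all sufficiently small $\epsilon>0$ $$\frac{1}{2\,Q!}\frac{\left(\log\frac1\epsilon\right)^{Q+1}}{\left(2\log\log\frac1\epsilon\right)^{Q}}\,(1+\delta_1(\epsilon))\le H_\epsilon(\mathcal B_Q)\le\frac{1}{Q!}\frac{\left(2\log\frac1\epsilon\right)^{Q+1}}{\left(\log\log\frac1\epsilon\right)^{Q}}\,(1+\delta_2(\epsilon)).$$ -/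

import Mathlib

open MeasureTheory Filter Topology Asymptotics
open scoped ENNReal NNReal

namespace EntireEntropy

noncomputable section

/-- The entropy `log 𝔑_ε(K)`, where `𝔑_ε(K)` is the least number of points of an `ε`-net for `K`
in the ambient space (closed balls, centres anywhere in the space). Meaningful for compact `K`,
where the minimal number is finite. -/
def entropy {X : Type*} [NormedAddCommGroup X] (ε : ℝ) (K : Set X) : ℝ :=
  Real.log ((Metric.externalCoveringNumber ε.toNNReal K).toNat : ℝ)

/-- The box `I_r = ∏ⱼ [-rⱼ, rⱼ]`. -/
def box {Q : ℕ} (r : Fin Q → ℝ) : Set (Fin Q → ℝ) :=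
  Set.univ.pi fun j => Set.Icc (-r j) (r j)

/-- Lebesgue measure on the box. -/
def boxMeasure {Q : ℕ} (r : Fin Q → ℝ) : Measure (Fin Q → ℝ) :=
  (volume : Measure (Fin Q → ℝ)).restrict (box r)

/-- Normalized univariate Chebyshev polynomial: `p₀ = 1`, `p_k(cos θ) = √2 cos (k θ)`, `k ≥ 1`. -/
def chebyshevP (k : ℕ) (x : ℝ) : ℝ :=
  if k = 0 then 1 else √2 * (Polynomial.Chebyshev.T ℝ (k : ℤ)).eval x

/-- `p_{k,r}(x) = ∏ⱼ p_{kⱼ}(xⱼ / rⱼ)`. -/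
def boxChebyshevP {Q : ℕ} (r : Fin Q → ℝ) (k : Fin Q → ℕ) (x : Fin Q → ℝ) : ℝ :=
  ∏ j, chebyshevP (k j) (x j / r j)

/-- The Chebyshev weight `v_r(x) = π^{-Q} (∏ⱼ (rⱼ² - xⱼ²))^{-1/2}` on the box. -/
def boxWeight {Q : ℕ} (r : Fin Q → ℝ) (x : Fin Q → ℝ) : ℝ :=
  (Real.pi ^ Q)⁻¹ * (√(∏ j, (r j ^ 2 - x j ^ 2)))⁻¹

/-- The Chebyshev coefficient `F̂_r(k) = ∫_{I_r} F p_{k,r} v_r`. -/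
def chebyshevCoeff {Q : ℕ} (r : Fin Q → ℝ) (F : (Fin Q → ℝ) → ℝ) (k : Fin Q → ℕ) : ℝ :=
  ∫ x, F x * boxChebyshevP r k x * boxWeight r x ∂(boxMeasure r)

/-- The homogeneous Chebyshev component `S_N(F) = ∑_{|k|₁ = N} F̂_r(k) p_{k,r}`. -/
def chebyshevComponent {Q : ℕ} (r : Fin Q → ℝ) (F : (Fin Q → ℝ) → ℝ) (N : ℕ)
    (x : Fin Q → ℝ) : ℝ :=
  ∑ k ∈ Finset.piAntidiag (Finset.univ : Finset (Fin Q)) N,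
    chebyshevCoeff r F k * boxChebyshevP r k x

/-- `Λ(N) = (2π/Q)^{Q/2} N^{Q/2} τ^N / N!`; in particular `Λ(0) = 0` for `Q ≥ 1`. -/
def radius (Q : ℕ) (τ : ℝ) (N : ℕ) : ℝ :=
  (2 * Real.pi / Q) ^ ((Q : ℝ) / 2) * (N : ℝ) ^ ((Q : ℝ) / 2) * (τ ^ N / (N.factorial : ℝ))

/-- The class `𝓑_Q(r, τ)` of real functions on `I_r` (modulo almost everywhere equality) with
`‖S_N(F)‖_{L∞(I_r)} ≤ Λ(N)` for all `N = 0, 1, 2, …`, as a subset of `L∞(I_r)`. -/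
def entireClass {Q : ℕ} (τ : ℝ) (r : Fin Q → ℝ) : Set (Lp ℝ ∞ (boxMeasure r)) :=
  {F | ∀ N : ℕ,
    eLpNorm (chebyshevComponent r F N) ∞ (boxMeasure r) ≤ ENNReal.ofReal (radius Q τ N)}

/-- `B₊(ε) = log (4/ε) + (Q/2) log (2eπτ/Q)`. -/
def upperB (Q : ℕ) (τ ε : ℝ) : ℝ :=
  Real.log (4 / ε) + (Q : ℝ) / 2 * Real.log (2 * Real.exp 1 * Real.pi * τ / Q)

/-- `B₋(ε) = log (1 / (4 √(2πeτ) ε)) + (Q/2) log (2π/Q)`. -/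
def lowerB (Q : ℕ) (τ ε : ℝ) : ℝ :=
  Real.log (1 / (4 * √(2 * Real.pi * Real.exp 1 * τ) * ε))
    + (Q : ℝ) / 2 * Real.log (2 * Real.pi / Q)

/-- `D(B) = B / (log B - log (eτ))`. -/
def quotD (τ B : ℝ) : ℝ :=
  B / (Real.log B - Real.log (Real.exp 1 * τ))

/-- `ξ_τ = 16 a log a / e + 2` with `a = max {3e²τ, 128}`. -/
def xi (τ : ℝ) : ℝ :=
  16 * max (3 * Real.exp 2 * τ) 128 * Real.log (max (3 * Real.exp 2 * τ) 128) / Real.exp 1 + 2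

end

end EntireEntropy

/-!
The Chebyshev products `p_{k,r}` are orthonormal for the probability density `v_r`, bounded by
`2 ^ (Q / 2)` on the box, and total: the span of `∏ⱼ T_{zⱼ}(xⱼ / rⱼ)`, `z ∈ ℤ^Q`, is stable under
multiplication by the coordinates, so by Stone–Weierstrass an element of `L∞` whose coefficients
all vanish is zero. Moreover each coefficient functional has norm at most `1` on `L∞`, since
`∫ |p_{k,r}| v_r ≤ 1`. As the radii `Λ(N)` are summable, every element of the class is the sum in
`L∞` of its components `S_N(F)`, with truncation error at most a tail of `∑ Λ(N)`
(`norm_sub_sum_componentVec_le`).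

Both entropy estimates come from grids in coefficient space, and no volume argument is needed.
For the upper one, the coefficients of degree at most `n`, which are bounded by `Λ(N)`, are rounded
to a grid (`entropy_le`). For the lower one, a grid of step `3ε` of coefficients, small
enough for the triangle inequality to keep each component below `Λ(N)`, gives a `2ε`-separated
subset of the class (`le_entropy`). There are `(n + Q).choose Q` coefficients, so the entropy
is compared with this dimension times the logarithm of the number of grid values.

The grids lose factors such as `2 ^ (Q / 2)` and the dimensions of the homogeneous spaces, at most
`2 ^ (N + Q)`; the claimed bounds have room for them. In the upper estimate the truncation
degree is `⌊2 D(B₊) + Q / 2⌋`, for which Stirling-type bounds make the tail at most `ε / 2`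
(`tsum_radius_le`). In the lower estimate it is `⌊D(B₋)⌋`: in this range each coefficient of
degree `N` has at least `exp ((N - 7) / 4)` admissible grid values (`exp_le_max_of_lowerB`), where
the factor `N ^ (Q / 2)` of `Λ(N)` absorbs the losses exponential in `Q` as soon as `N ≥ 8`.

For the asymptotics the same two estimates are used, the upper one with the same degree and the
lower one with degree `⌊0.6 L / log L⌋`, `L = log (1 / ε)`. Since `Q ≥ 28` is forced by `τ ≥ 1`, the
leading constants are beaten by a fixed factor, and both `δ₁` and `δ₂` may be taken equal to
`Q log L / L`.
-/

namespace EntireEntropy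

/-! ### Orthonormality of the product Chebyshev polynomials -/

/-- The univariate Chebyshev weight `π⁻¹ (ρ² - x²)^{-1/2}`, a probability density on `[-ρ, ρ]`. -/
noncomputable def chebyshevWeight (ρ x : ℝ) : ℝ := Real.pi⁻¹ * (√(ρ ^ 2 - x ^ 2))⁻¹

lemma chebyshevWeight_eq {ρ : ℝ} (hρ : 0 < ρ) (x : ℝ) :
    chebyshevWeight ρ x = ρ⁻¹ * (Real.pi⁻¹ * √(1 - (x / ρ) ^ 2)⁻¹) := by
  have h : ρ ^ 2 - x ^ 2 = ρ ^ 2 * (1 - (x / ρ) ^ 2) := by field_simp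
  rw [chebyshevWeight, h, Real.sqrt_mul (by positivity), Real.sqrt_sq hρ.le, mul_inv, Real.sqrt_inv]
  ring

lemma integrableOn_chebyshevWeight {ρ : ℝ} (hρ : 0 < ρ) :
    IntegrableOn (chebyshevWeight ρ) (Set.Icc (-ρ) ρ) := by
  rw [integrableOn_Icc_iff_integrableOn_Ioc,
    ← intervalIntegrable_iff_integrableOn_Ioc_of_le (by linarith)]
  have h := (Polynomial.Chebyshev.intervalIntegrable_sqrt_one_sub_sq_inv.const_mul
    (ρ⁻¹ * Real.pi⁻¹)).comp_mul_left (c := ρ⁻¹)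
  have h2 : chebyshevWeight ρ = fun x => ρ⁻¹ * Real.pi⁻¹ * √(1 - (ρ⁻¹ * x) ^ 2)⁻¹ := by
    ext x; rw [chebyshevWeight_eq hρ]; ring_nf
  rw [h2]
  simpa using h

lemma integral_comp_div_mul_chebyshevWeight {ρ : ℝ} (hρ : 0 < ρ) (f : ℝ → ℝ) :
    ∫ x in Set.Icc (-ρ) ρ, f (x / ρ) * chebyshevWeight ρ x =
      Real.pi⁻¹ * ∫ x, f x ∂Polynomial.Chebyshev.measureT := by
  rw [Polynomial.Chebyshev.integral_measureT, integral_Icc_eq_integral_Ioc,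
    ← intervalIntegral.integral_of_le (by linarith)]
  have h : ∀ x, f (x / ρ) * chebyshevWeight ρ x =
      (fun u => ρ⁻¹ * Real.pi⁻¹ * (f u * √(1 - u ^ 2)⁻¹)) (x / ρ) := by
    intro x; rw [chebyshevWeight_eq hρ]; ring
  simp_rw [h]
  rw [intervalIntegral.integral_comp_div (fun u => ρ⁻¹ * Real.pi⁻¹ * (f u * √(1 - u ^ 2)⁻¹)) hρ.ne',
    neg_div, div_self hρ.ne', intervalIntegral.integral_const_mul, smul_eq_mul]
  field_simp

lemma integral_chebyshevP_mul_measureT (k l : ℕ) :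
    Real.pi⁻¹ * ∫ x, chebyshevP k x * chebyshevP l x ∂Polynomial.Chebyshev.measureT =
      if k = l then 1 else 0 := by
  have h2 : √2 * √2 = 2 := Real.mul_self_sqrt (by norm_num)
  have hπ := Real.pi_ne_zero
  have key : ∀ k, ∃ c : ℝ, (∀ x, chebyshevP k x = c * (Polynomial.Chebyshev.T ℝ (k : ℤ)).eval x) ∧
      ((k = 0 ∧ c = 1) ∨ (k ≠ 0 ∧ c = √2)) := by
    intro k
    by_cases hk : k = 0
    · exact ⟨1, fun x => by simp [chebyshevP, hk], Or.inl ⟨hk, rfl⟩⟩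
    · exact ⟨√2, fun x => by simp [chebyshevP, hk], Or.inr ⟨hk, rfl⟩⟩
  obtain ⟨c, hc, hc'⟩ := key k
  obtain ⟨d, hd, hd'⟩ := key l
  have : ∀ x, chebyshevP k x * chebyshevP l x = (c * d) *
      ((Polynomial.Chebyshev.T ℝ (k : ℤ)).eval x * (Polynomial.Chebyshev.T ℝ (l : ℤ)).eval x) := by
    intro x; rw [hc, hd]; ring
  simp_rw [this]
  rw [integral_const_mul]
  split_ifs with h
  · subst h
    rcases hc' with ⟨h0, h1⟩ | ⟨h0, h1⟩
    · have h3 : d = 1 := by rcases hd' with h | h; exacts [h.2, absurd h0 h.1]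
      subst h0
      rw [h1, h3, Nat.cast_zero, Polynomial.Chebyshev.integral_eval_T_real_mul_self_measureT_zero]
      field_simp
    · have h3 : d = √2 := by rcases hd' with h | h; exacts [absurd h.1 h0, h.2]
      rw [h1, h3, Polynomial.Chebyshev.integral_T_real_mul_self_measureT_of_ne_zero h0, h2]
      field_simp
  · rw [Polynomial.Chebyshev.integral_eval_T_real_mul_eval_T_real_measureT_of_ne h]; simp

lemma continuous_chebyshevP (k : ℕ) : Continuous (chebyshevP k) := by
  unfold chebyshevP
  split_ifs
  · exact continuous_const
  · exact continuous_const.mul (Polynomial.continuous _)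

lemma abs_chebyshevP_le (k : ℕ) {x : ℝ} (hx : |x| ≤ 1) : |chebyshevP k x| ≤ √2 := by
  unfold chebyshevP
  split_ifs
  · simp
  · rw [abs_mul, abs_of_nonneg (Real.sqrt_nonneg 2)]
    exact mul_le_of_le_one_right (Real.sqrt_nonneg 2)
      (Polynomial.Chebyshev.abs_eval_T_real_le_one k hx)

variable {Q : ℕ} {r : Fin Q → ℝ}

lemma boxMeasure_eq_pi (r : Fin Q → ℝ) :
    boxMeasure r = Measure.pi fun j => volume.restrict (Set.Icc (-r j) (r j)) := by
  rw [boxMeasure, box, volume_pi, Measure.restrict_pi_pi]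

lemma measurableSet_box (r : Fin Q → ℝ) : MeasurableSet (box r) :=
  MeasurableSet.univ_pi fun _ => measurableSet_Icc

lemma isCompact_box (r : Fin Q → ℝ) : IsCompact (box r) :=
  isCompact_univ_pi fun _ => isCompact_Icc

instance instIsFiniteMeasureBoxMeasure (r : Fin Q → ℝ) : IsFiniteMeasure (boxMeasure r) :=
  ⟨by rw [boxMeasure, Measure.restrict_apply_univ]; exact (isCompact_box r).measure_lt_top⟩

lemma ae_mem_box (r : Fin Q → ℝ) : ∀ᵐ x ∂boxMeasure r, x ∈ box r :=
  ae_restrict_mem (measurableSet_box r)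

lemma boxWeight_eq_prod {x : Fin Q → ℝ} (hx : x ∈ box r) :
    boxWeight r x = ∏ j, chebyshevWeight (r j) (x j) := by
  have hx' : ∀ j, 0 ≤ r j ^ 2 - x j ^ 2 := fun j => by
    have := hx j (Set.mem_univ j)
    rw [Set.mem_Icc] at this
    nlinarith [this.1, this.2]
  simp only [chebyshevWeight, Finset.prod_mul_distrib, boxWeight, Finset.prod_const,
    Finset.card_univ, Fintype.card_fin, Finset.prod_inv_distrib, inv_pow]
  rw [Real.sqrt_prod _ fun j _ => hx' j]

lemma boxWeight_nonneg (r : Fin Q → ℝ) (x : Fin Q → ℝ) : 0 ≤ boxWeight r x := by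
  unfold boxWeight; positivity

lemma boxWeight_ae_eq (r : Fin Q → ℝ) :
    boxWeight r =ᵐ[boxMeasure r] fun x => ∏ j, chebyshevWeight (r j) (x j) := by
  filter_upwards [ae_mem_box r] with x hx using boxWeight_eq_prod hx

lemma integrable_boxWeight (hr : ∀ j, 0 < r j) : Integrable (boxWeight r) (boxMeasure r) := by
  refine Integrable.congr ?_ (boxWeight_ae_eq r).symm
  rw [boxMeasure_eq_pi]
  exact Integrable.fintype_prod fun j => integrableOn_chebyshevWeight (hr j)

lemma integral_prod_mul_boxWeight (hr : ∀ j, 0 < r j) (f : Fin Q → ℝ → ℝ) :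
    ∫ x, (∏ j, f j (x j / r j)) * boxWeight r x ∂boxMeasure r =
      ∏ j, (Real.pi⁻¹ * ∫ x, f j x ∂Polynomial.Chebyshev.measureT) := by
  have h : (fun x => (∏ j, f j (x j / r j)) * boxWeight r x) =ᵐ[boxMeasure r]
      fun x => ∏ j, (f j (x j / r j) * chebyshevWeight (r j) (x j)) := by
    filter_upwards [boxWeight_ae_eq r] with x hx
    rw [hx, Finset.prod_mul_distrib]
  rw [integral_congr_ae h, boxMeasure_eq_pi,
    integral_fintype_prod_eq_prod
      (f := fun j y => f j (y / r j) * chebyshevWeight (r j) y)]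
  exact Finset.prod_congr rfl fun j _ => integral_comp_div_mul_chebyshevWeight (hr j) (f j)

/-- Orthonormality of the product Chebyshev polynomials for the Chebyshev weight. -/
lemma integral_boxChebyshevP_mul (hr : ∀ j, 0 < r j) (k l : Fin Q → ℕ) :
    ∫ x, boxChebyshevP r k x * boxChebyshevP r l x * boxWeight r x ∂boxMeasure r =
      if k = l then 1 else 0 := by
  have h := integral_prod_mul_boxWeight hr fun j y => chebyshevP (k j) y * chebyshevP (l j) y
  simp_rw [integral_chebyshevP_mul_measureT, Finset.prod_mul_distrib] at h
  rw [show (∏ j, if k j = l j then (1 : ℝ) else 0) = if k = l then 1 else 0 by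
    rw [Finset.prod_ite_zero]; simp [funext_iff]] at h
  exact h

lemma continuous_boxChebyshevP (r : Fin Q → ℝ) (k : Fin Q → ℕ) :
    Continuous (boxChebyshevP r k) :=
  continuous_finsetProd _ fun j _ =>
    (continuous_chebyshevP _).comp ((continuous_apply j).div_const _)

lemma abs_boxChebyshevP_le (hr : ∀ j, 0 < r j) (k : Fin Q → ℕ) {x : Fin Q → ℝ} (hx : x ∈ box r) :
    |boxChebyshevP r k x| ≤ √2 ^ Q := by
  rw [boxChebyshevP, Finset.abs_prod]
  calc ∏ j, |chebyshevP (k j) (x j / r j)| ≤ ∏ _j : Fin Q, √2 := by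
        refine Finset.prod_le_prod (fun _ _ => abs_nonneg _) fun j _ => abs_chebyshevP_le _ ?_
        have := hx j (Set.mem_univ j)
        rw [abs_div, abs_of_pos (hr j), div_le_one (hr j), abs_le]
        exact this
    _ = √2 ^ Q := by simp

lemma integral_boxWeight (hr : ∀ j, 0 < r j) : ∫ x, boxWeight r x ∂boxMeasure r = 1 := by
  have := integral_boxChebyshevP_mul hr 0 0
  simpa [boxChebyshevP, chebyshevP] using this

/-- The integral kernel `p_{k,r} v_r` of the `k`-th coefficient functional. -/
noncomputable def coeffKernel (r : Fin Q → ℝ) (k : Fin Q → ℕ) (x : Fin Q → ℝ) : ℝ :=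
  boxChebyshevP r k x * boxWeight r x

lemma integrable_coeffKernel (hr : ∀ j, 0 < r j) (k : Fin Q → ℕ) :
    Integrable (coeffKernel r k) (boxMeasure r) := by
  refine (integrable_boxWeight hr).bdd_mul (c := √2 ^ Q)
    (continuous_boxChebyshevP r k).aestronglyMeasurable ?_
  filter_upwards [ae_mem_box r] with x hx using abs_boxChebyshevP_le hr k hx

/-- The kernel has `L¹` norm at most `1`: integrate `|p| ≤ (1 + p²) / 2` against `v_r`. -/
lemma integral_abs_coeffKernel_le (hr : ∀ j, 0 < r j) (k : Fin Q → ℕ) :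
    ∫ x, |coeffKernel r k x| ∂boxMeasure r ≤ 1 := by
  have hsq : Integrable (fun x => boxChebyshevP r k x * boxChebyshevP r k x * boxWeight r x)
      (boxMeasure r) := by
    simp_rw [mul_assoc]
    refine (integrable_coeffKernel hr k).bdd_mul (c := √2 ^ Q)
      (continuous_boxChebyshevP r k).aestronglyMeasurable ?_
    filter_upwards [ae_mem_box r] with x hx using abs_boxChebyshevP_le hr k hx
  have hi := (((integrable_boxWeight hr).add hsq).const_mul (1 / 2))
  refine (integral_mono (integrable_coeffKernel hr k).abs hi fun x => ?_).trans ?_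
  · have hw := boxWeight_nonneg r x
    simp only [coeffKernel, abs_mul, abs_of_nonneg hw, Pi.add_apply]
    nlinarith [mul_nonneg hw (sq_nonneg (|boxChebyshevP r k x| - 1)),
      sq_abs (boxChebyshevP r k x)]
  · simp only [Pi.add_apply]
    rw [integral_const_mul, integral_add (integrable_boxWeight hr) hsq, integral_boxWeight hr,
      integral_boxChebyshevP_mul hr]
    norm_num

/-! ### The Chebyshev system in `L∞` -/

lemma ae_abs_le_norm (F : Lp ℝ ∞ (boxMeasure r)) : ∀ᵐ x ∂boxMeasure r, |F x| ≤ ‖F‖ := by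
  filter_upwards [ae_le_eLpNormEssSup (f := F) (μ := boxMeasure r)] with x hx
  rw [← eLpNorm_exponent_top] at hx
  rw [Lp.norm_def, ← Real.norm_eq_abs, ← toReal_enorm]
  exact ENNReal.toReal_mono (Lp.eLpNorm_ne_top F) hx

lemma chebyshevCoeff_eq (F : (Fin Q → ℝ) → ℝ) (k : Fin Q → ℕ) :
    chebyshevCoeff r F k = ∫ x, F x * coeffKernel r k x ∂boxMeasure r := by
  simp only [chebyshevCoeff, coeffKernel, mul_assoc]

lemma integrable_mul_of_Lp (F : Lp ℝ ∞ (boxMeasure r)) {g : (Fin Q → ℝ) → ℝ}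
    (hg : Integrable g (boxMeasure r)) : Integrable (fun x => F x * g x) (boxMeasure r) :=
  hg.bdd_mul (c := ‖F‖) (Lp.aestronglyMeasurable F) (ae_abs_le_norm F)

/-- The `k`-th Chebyshev coefficient as a continuous functional on `L∞`. -/
noncomputable def coeffFunctional (hr : ∀ j, 0 < r j) (k : Fin Q → ℕ) :
    Lp ℝ ∞ (boxMeasure r) →L[ℝ] ℝ :=
  LinearMap.mkContinuous
    { toFun := fun F => chebyshevCoeff r F k
      map_add' := fun F G => by
        simp only [chebyshevCoeff_eq]
        rw [← integral_add (integrable_mul_of_Lp F (integrable_coeffKernel hr k))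
          (integrable_mul_of_Lp G (integrable_coeffKernel hr k))]
        refine integral_congr_ae ?_
        filter_upwards [Lp.coeFn_add F G] with x hx
        rw [hx, Pi.add_apply, add_mul]
      map_smul' := fun c F => by
        simp only [chebyshevCoeff_eq, RingHom.id_apply, smul_eq_mul]
        rw [← integral_const_mul]
        refine integral_congr_ae ?_
        filter_upwards [Lp.coeFn_smul c F] with x hx
        rw [hx, Pi.smul_apply, smul_eq_mul, mul_assoc] } 1 fun F => by
    simp only [LinearMap.coe_mk, AddHom.coe_mk, chebyshevCoeff_eq, one_mul]
    refine (norm_integral_le_of_norm_le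
      ((integrable_coeffKernel hr k).abs.const_mul ‖F‖) ?_).trans ?_
    · filter_upwards [ae_abs_le_norm F] with x hx
      rw [norm_mul, Real.norm_eq_abs, Real.norm_eq_abs]
      gcongr
    · rw [integral_const_mul]
      exact mul_le_of_le_one_right (norm_nonneg F) (integral_abs_coeffKernel_le hr k)

@[simp] lemma coeffFunctional_apply (hr : ∀ j, 0 < r j) (k : Fin Q → ℕ)
    (F : Lp ℝ ∞ (boxMeasure r)) : coeffFunctional hr k F = chebyshevCoeff r F k := rfl

lemma abs_chebyshevCoeff_le (hr : ∀ j, 0 < r j) (k : Fin Q → ℕ)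
    (F : Lp ℝ ∞ (boxMeasure r)) : |chebyshevCoeff r F k| ≤ ‖F‖ := by
  have := (coeffFunctional hr k).le_of_opNorm_le (LinearMap.mkContinuous_norm_le _ zero_le_one _) F
  simpa using this

lemma memLp_boxChebyshevP (hr : ∀ j, 0 < r j) (k : Fin Q → ℕ) :
    MemLp (boxChebyshevP r k) ∞ (boxMeasure r) := by
  refine memLp_top_of_bound (continuous_boxChebyshevP r k).aestronglyMeasurable (√2 ^ Q) ?_
  filter_upwards [ae_mem_box r] with x hx using abs_boxChebyshevP_le hr k hx

/-- The product Chebyshev polynomial `p_{k,r}` as an element of `L∞`. -/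
noncomputable def chebyshevVec (hr : ∀ j, 0 < r j) (k : Fin Q → ℕ) : Lp ℝ ∞ (boxMeasure r) :=
  (memLp_boxChebyshevP hr k).toLp _

lemma chebyshevVec_ae_eq (hr : ∀ j, 0 < r j) (k : Fin Q → ℕ) :
    chebyshevVec hr k =ᵐ[boxMeasure r] boxChebyshevP r k := MemLp.coeFn_toLp _

lemma norm_chebyshevVec_le (hr : ∀ j, 0 < r j) (k : Fin Q → ℕ) :
    ‖chebyshevVec hr k‖ ≤ √2 ^ Q := by
  have h : ∀ᵐ x ∂boxMeasure r, ‖boxChebyshevP r k x‖ ≤ √2 ^ Q := by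
    filter_upwards [ae_mem_box r] with x hx using abs_boxChebyshevP_le hr k hx
  rw [chebyshevVec, Lp.norm_toLp, eLpNorm_exponent_top]
  exact ENNReal.toReal_le_of_le_ofReal (by positivity) (eLpNormEssSup_le_of_ae_bound h)

lemma chebyshevCoeff_chebyshevVec (hr : ∀ j, 0 < r j) (k l : Fin Q → ℕ) :
    chebyshevCoeff r (chebyshevVec hr l) k = if k = l then 1 else 0 := by
  rw [← integral_boxChebyshevP_mul hr k l, chebyshevCoeff]
  refine integral_congr_ae ?_
  filter_upwards [chebyshevVec_ae_eq hr l] with x hx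
  rw [hx]; ring

/-- The homogeneous component `S_N(F)` as an element of `L∞`. -/
noncomputable def componentVec (hr : ∀ j, 0 < r j) (N : ℕ) (F : Lp ℝ ∞ (boxMeasure r)) :
    Lp ℝ ∞ (boxMeasure r) :=
  ∑ k ∈ Finset.piAntidiag (Finset.univ : Finset (Fin Q)) N,
    chebyshevCoeff r F k • chebyshevVec hr k

lemma componentVec_ae_eq (hr : ∀ j, 0 < r j) (N : ℕ) (F : Lp ℝ ∞ (boxMeasure r)) :
    componentVec hr N F =ᵐ[boxMeasure r] chebyshevComponent r F N := by
  have h1 := Lp.coeFn_finsetSum (Finset.piAntidiag (Finset.univ : Finset (Fin Q)) N)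
    (fun k => chebyshevCoeff r F k • chebyshevVec hr k)
  have h2 : ∀ᵐ x ∂boxMeasure r, ∀ k : Fin Q → ℕ,
      (chebyshevCoeff r F k • chebyshevVec hr k : Lp ℝ ∞ (boxMeasure r)) x =
        chebyshevCoeff r F k * boxChebyshevP r k x := by
    rw [ae_all_iff]
    intro k
    filter_upwards [chebyshevVec_ae_eq hr k,
      Lp.coeFn_smul (chebyshevCoeff r F k) (chebyshevVec hr k)] with x hx hx2
    rw [hx2, Pi.smul_apply, hx, smul_eq_mul]
  filter_upwards [h1, h2] with x hx hx2
  rw [componentVec, hx, chebyshevComponent, Finset.sum_apply]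
  exact Finset.sum_congr rfl fun k _ => hx2 k

lemma radius_nonneg {τ : ℝ} (hτ : 0 ≤ τ) (N : ℕ) : 0 ≤ radius Q τ N := by
  unfold radius; positivity

lemma mem_entireClass_iff (hr : ∀ j, 0 < r j) {τ : ℝ} (hτ : 0 ≤ τ)
    {F : Lp ℝ ∞ (boxMeasure r)} :
    F ∈ entireClass τ r ↔ ∀ N, ‖componentVec hr N F‖ ≤ radius Q τ N := by
  refine forall_congr' fun N => ?_
  rw [← eLpNorm_congr_ae (componentVec_ae_eq hr N F), Lp.norm_def,
    ENNReal.le_ofReal_iff_toReal_le (Lp.eLpNorm_ne_top _) (radius_nonneg hτ N)]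

lemma continuous_componentVec (hr : ∀ j, 0 < r j) (N : ℕ) : Continuous (componentVec hr N) :=
  continuous_finsetSum _ fun k _ => ((coeffFunctional hr k).continuous).smul continuous_const

lemma isClosed_entireClass (hr : ∀ j, 0 < r j) {τ : ℝ} (hτ : 0 ≤ τ) :
    IsClosed (entireClass τ r) := by
  have : entireClass τ r = ⋂ N, {F | ‖componentVec hr N F‖ ≤ radius Q τ N} := by
    ext F; rw [mem_entireClass_iff hr hτ, Set.mem_iInter]; rfl
  rw [this]
  exact isClosed_iInter fun N =>
    isClosed_le (continuous_componentVec hr N).norm continuous_const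

/-! ### Totality of the Chebyshev coefficients -/

/-- The unnormalized products `∏ⱼ T_{zⱼ}(xⱼ / rⱼ)`, indexed by `ℤ^Q` so that multiplication by a
coordinate is a shift of the index. -/
noncomputable def chebyshevTProd (r : Fin Q → ℝ) (z : Fin Q → ℤ) : C(Fin Q → ℝ, ℝ) where
  toFun x := ∏ j, (Polynomial.Chebyshev.T ℝ (z j)).eval (x j / r j)
  continuous_toFun := continuous_finsetProd _ fun j _ =>
    (Polynomial.continuous _).comp ((continuous_apply j).div_const _)

lemma exists_chebyshevTProd_eq (z : Fin Q → ℤ) :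
    ∃ c : ℝ, ∀ x, chebyshevTProd r z x = c * boxChebyshevP r (fun j => (z j).natAbs) x := by
  refine ⟨∏ j, (if (z j).natAbs = 0 then (1 : ℝ) else (√2)⁻¹), fun x => ?_⟩
  rw [boxChebyshevP, ← Finset.prod_mul_distrib]
  change ∏ j, (Polynomial.Chebyshev.T ℝ (z j)).eval (x j / r j) = _
  refine Finset.prod_congr rfl fun j _ => ?_
  rw [chebyshevP, Polynomial.Chebyshev.T_natAbs]
  split_ifs with h
  · rw [Int.natAbs_eq_zero.1 h]; simp
  · rw [inv_mul_cancel_left₀ (by positivity)]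

/-- The coordinate functions. -/
def coordMap (j : Fin Q) : C(Fin Q → ℝ, ℝ) := ⟨fun x => x j, continuous_apply j⟩

lemma coordMap_mul_chebyshevTProd (hr : ∀ j, 0 < r j) (j : Fin Q) (z : Fin Q → ℤ) :
    coordMap j * chebyshevTProd r z = (r j / 2) •
      (chebyshevTProd r (Function.update z j (z j + 1)) +
        chebyshevTProd r (Function.update z j (z j - 1))) := by
  ext x
  have hs : ∀ m : ℤ, chebyshevTProd r (Function.update z j m) x =
      (Polynomial.Chebyshev.T ℝ m).eval (x j / r j) *
        ∏ i ∈ Finset.univ.erase j, (Polynomial.Chebyshev.T ℝ (z i)).eval (x i / r i) := by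
    intro m
    rw [chebyshevTProd, ContinuousMap.coe_mk,
      ← Finset.mul_prod_erase Finset.univ _ (Finset.mem_univ j), Function.update_self]
    congr 1
    refine Finset.prod_congr rfl fun i hi => ?_
    rw [Function.update_of_ne (Finset.ne_of_mem_erase hi)]
  have h0 := hs (z j)
  rw [Function.update_eq_self] at h0
  have hrec : (Polynomial.Chebyshev.T ℝ (z j + 1)).eval (x j / r j) =
      2 * (x j / r j) * (Polynomial.Chebyshev.T ℝ (z j)).eval (x j / r j) -
        (Polynomial.Chebyshev.T ℝ (z j - 1)).eval (x j / r j) := by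
    rw [Polynomial.Chebyshev.T_add_one]; simp
  have := (hr j).ne'
  simp only [ContinuousMap.mul_apply, ContinuousMap.smul_apply, ContinuousMap.add_apply, hs, h0,
    hrec, coordMap, ContinuousMap.coe_mk, smul_eq_mul]
  field_simp
  ring

lemma adjoin_coordMap_le_span (hr : ∀ j, 0 < r j) {f : C(Fin Q → ℝ, ℝ)}
    (hf : f ∈ Algebra.adjoin ℝ (Set.range (coordMap (Q := Q)))) :
    f ∈ Submodule.span ℝ (Set.range (chebyshevTProd r)) := by
  set V := Submodule.span ℝ (Set.range (chebyshevTProd r))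
  have h1 : (1 : C(Fin Q → ℝ, ℝ)) ∈ V := by
    refine Submodule.subset_span ⟨0, ?_⟩
    ext x; simp [chebyshevTProd]
  suffices h : ∀ v ∈ V, f * v ∈ V by simpa using h 1 h1
  induction hf using Algebra.adjoin_induction with
  | mem f hf =>
    obtain ⟨j, rfl⟩ := hf
    intro v hv
    induction hv using Submodule.span_induction with
    | mem v hv =>
      obtain ⟨z, rfl⟩ := hv
      rw [coordMap_mul_chebyshevTProd hr]
      exact V.smul_mem _ (V.add_mem (Submodule.subset_span ⟨_, rfl⟩)
        (Submodule.subset_span ⟨_, rfl⟩))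
    | zero => simp
    | add v w _ _ hv hw => rw [mul_add]; exact V.add_mem hv hw
    | smul c v _ hv => rw [mul_smul_comm]; exact V.smul_mem c hv
  | algebraMap c =>
    intro v hv
    rw [← Algebra.smul_def]; exact V.smul_mem c hv
  | add f g _ _ hf hg => intro v hv; rw [add_mul]; exact V.add_mem (hf v hv) (hg v hv)
  | mul f g _ _ hf hg => intro v hv; rw [mul_assoc]; exact hf _ (hg v hv)

lemma integrable_mul_mul_boxWeight (hr : ∀ j, 0 < r j) (G : Lp ℝ ∞ (boxMeasure r))
    (f : C(Fin Q → ℝ, ℝ)) :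
    Integrable (fun x => f x * (G x * boxWeight r x)) (boxMeasure r) := by
  obtain ⟨c, hc⟩ := (isCompact_box r).exists_bound_of_continuousOn f.continuous.continuousOn
  refine (integrable_mul_of_Lp G (integrable_boxWeight hr)).bdd_mul (c := c)
    f.continuous.aestronglyMeasurable ?_
  filter_upwards [ae_mem_box r] with x hx using hc x hx

lemma integral_mul_eq_zero_of_mem_span (hr : ∀ j, 0 < r j) {G : Lp ℝ ∞ (boxMeasure r)}
    (hG : ∀ k, chebyshevCoeff r G k = 0) {f : C(Fin Q → ℝ, ℝ)}
    (hf : f ∈ Submodule.span ℝ (Set.range (chebyshevTProd r))) :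
    ∫ x, f x * (G x * boxWeight r x) ∂boxMeasure r = 0 := by
  induction hf using Submodule.span_induction with
  | mem f hf =>
    obtain ⟨z, rfl⟩ := hf
    obtain ⟨c, hc⟩ := exists_chebyshevTProd_eq (r := r) z
    have := hG fun j => (z j).natAbs
    rw [chebyshevCoeff] at this
    simp_rw [hc, mul_assoc]
    rw [integral_const_mul]
    simp_rw [← mul_assoc, mul_comm (boxChebyshevP r _ _), this, mul_zero]
  | zero => simp
  | add f g _ _ hf hg =>
    simp only [ContinuousMap.add_apply, add_mul]
    rw [integral_add (integrable_mul_mul_boxWeight hr G f) (integrable_mul_mul_boxWeight hr G g),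
      hf, hg, add_zero]
  | smul c f _ hf =>
    simp only [ContinuousMap.smul_apply, smul_eq_mul, mul_assoc]
    rw [integral_const_mul, hf, mul_zero]

lemma integral_continuousMap_mul_eq_zero (hr : ∀ j, 0 < r j) {G : Lp ℝ ∞ (boxMeasure r)}
    (hG : ∀ k, chebyshevCoeff r G k = 0) (f : C(Fin Q → ℝ, ℝ)) :
    ∫ x, f x * (G x * boxWeight r x) ∂boxMeasure r = 0 := by
  have hsep : (Algebra.adjoin ℝ (Set.range (coordMap (Q := Q)))).SeparatesPoints := by
    intro x y hxy
    obtain ⟨j, hj⟩ := Function.ne_iff.1 hxy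
    exact ⟨_, ⟨coordMap j, Algebra.subset_adjoin ⟨j, rfl⟩, rfl⟩, hj⟩
  have hGw := integrable_mul_of_Lp G (integrable_boxWeight hr)
  set I := ∫ x, |G x * boxWeight r x| ∂boxMeasure r with hI
  have hI0 : 0 ≤ I := integral_nonneg fun x => abs_nonneg _
  refine abs_eq_zero.1 (le_antisymm (le_of_forall_pos_le_add fun δ hδ => ?_) (abs_nonneg _))
  have hδ' : 0 < δ / (I + 1) := by positivity
  obtain ⟨g, hg, hgf⟩ :=
    ContinuousMap.exists_mem_subalgebra_near_continuous_of_isCompact_of_separatesPoints hsep f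
      (isCompact_box r) hδ'
  have hg0 := integral_mul_eq_zero_of_mem_span hr hG (adjoin_coordMap_le_span hr hg)
  rw [zero_add, ← sub_zero (∫ x, f x * (G x * boxWeight r x) ∂boxMeasure r), ← hg0,
    ← integral_sub (integrable_mul_mul_boxWeight hr G f) (integrable_mul_mul_boxWeight hr G g),
    ← Real.norm_eq_abs]
  refine (norm_integral_le_of_norm_le (hGw.abs.const_mul (δ / (I + 1))) ?_).trans ?_
  · filter_upwards [ae_mem_box r] with x hx
    rw [← sub_mul, norm_mul, Real.norm_eq_abs (G x * _), norm_sub_rev]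
    exact mul_le_mul_of_nonneg_right (hgf x hx).le (abs_nonneg _)
  · rw [integral_const_mul, div_mul_eq_mul_div, div_le_iff₀ (by positivity)]
    nlinarith

lemma boxWeight_pos_ae (r : Fin Q → ℝ) : ∀ᵐ x ∂boxMeasure r, 0 < boxWeight r x := by
  have h : ∀ᵐ x ∂boxMeasure r, ∀ j, x j ≠ r j ∧ x j ≠ -r j := by
    rw [ae_all_iff]
    intro j
    have h1 : ∀ c : ℝ, ∀ᵐ x ∂boxMeasure r, x j ≠ c := fun c =>
      ae_restrict_of_ae (by rw [volume_pi]; exact Measure.ae_eval_ne (α := fun _ : Fin Q => ℝ) (μ := fun _ => volume) j c)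
    filter_upwards [h1 (r j), h1 (-r j)] with x hx hx2 using ⟨hx, hx2⟩
  filter_upwards [h, ae_mem_box r] with x hx hxb
  rw [boxWeight_eq_prod hxb]
  refine Finset.prod_pos fun j _ => mul_pos (inv_pos.2 Real.pi_pos) (inv_pos.2 (Real.sqrt_pos.2 ?_))
  have hb := hxb j (Set.mem_univ j)
  have h1 := lt_of_le_of_ne hb.1 (hx j).2.symm
  have h2 := lt_of_le_of_ne hb.2 (hx j).1
  nlinarith

/-- An element of `L∞` is determined by its Chebyshev coefficients. -/
lemma eq_zero_of_chebyshevCoeff_eq_zero (hr : ∀ j, 0 < r j) {G : Lp ℝ ∞ (boxMeasure r)}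
    (hG : ∀ k, chebyshevCoeff r G k = 0) : G = 0 := by
  have h := ae_eq_zero_of_integral_contDiff_smul_eq_zero (μ := boxMeasure r)
    (integrable_mul_of_Lp G (integrable_boxWeight hr)).locallyIntegrable fun g hg _ => by
      exact integral_continuousMap_mul_eq_zero hr hG ⟨g, hg.continuous⟩
  rw [Lp.eq_zero_iff_ae_eq_zero]
  filter_upwards [h, boxWeight_pos_ae r] with x hx hw
  exact (mul_eq_zero.1 hx).resolve_right hw.ne'

/-! ### Covering and packing by coefficient grids -/

section Abstract

variable {X ι : Type*} [NormedAddCommGroup X] [NormedSpace ℝ X]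

/-- A set whose elements are, up to `t`, combinations of finitely many vectors with bounded
coefficients is covered by rounding each coefficient to a grid of mesh `2η`. -/
lemma exists_isCover_of_coeff_bound (s : Finset ι) (e : ι → X) (φ : ι → X → ℝ) (K : Set X)
    (a : ι → ℝ) {b t η ε : ℝ} (hη : 0 < η) (he : ∀ i ∈ s, ‖e i‖ ≤ b)
    (ha : ∀ F ∈ K, ∀ i ∈ s, |φ i F| ≤ a i)
    (ht : ∀ F ∈ K, ‖F - ∑ i ∈ s, φ i F • e i‖ ≤ t) (hε : t + s.card * (η * b) ≤ ε) :
    ∃ C : Finset X, C.card ≤ ∏ i ∈ s, (⌊a i / η⌋₊ + 1) ∧ Metric.IsCover ε.toNNReal K (C : Set X) := by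
  classical
  refine ⟨(s.pi fun i => Finset.range (⌊a i / η⌋₊ + 1)).image fun m =>
    ∑ i ∈ s.attach, (-a i + η * (2 * (m i.1 i.2 : ℝ) + 1)) • e i, ?_, ?_⟩
  · refine Finset.card_image_le.trans ?_
    rw [Finset.card_pi]
    simp
  · rw [Metric.isCover_iff_subset_iUnion_closedBall]
    intro F hF
    simp only [Set.mem_iUnion, Finset.mem_coe, Finset.mem_image, exists_prop]
    refine ⟨_, ⟨fun i _ => ⌊(φ i F + a i) / (2 * η)⌋₊, ?_, rfl⟩, ?_⟩
    · rw [Finset.mem_pi]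
      intro i hi
      rw [Finset.mem_range, Nat.lt_succ_iff]
      refine Nat.floor_le_floor ?_
      rw [div_le_div_iff₀ (by positivity) hη]
      nlinarith [(abs_le.1 (ha F hF i hi)).2]
    · rw [Metric.mem_closedBall, dist_eq_norm]
      refine le_trans ?_ (hε.trans (Real.le_coe_toNNReal ε))
      rw [Finset.sum_attach s fun i =>
        (-a i + η * (2 * (⌊(φ i F + a i) / (2 * η)⌋₊ : ℝ) + 1)) • e i,
        ← sub_add_sub_cancel F (∑ i ∈ s, φ i F • e i), ← Finset.sum_sub_distrib]
      refine (norm_add_le _ _).trans (add_le_add (ht F hF) ?_)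
      refine (norm_sum_le _ _).trans ?_
      rw [← nsmul_eq_mul]
      refine Finset.sum_le_card_nsmul _ _ _ fun i hi => ?_
      rw [← sub_smul, norm_smul]
      have h0 : 0 ≤ (φ i F + a i) / (2 * η) :=
        div_nonneg (by linarith [(abs_le.1 (ha F hF i hi)).1]) (by positivity)
      have h1 := Nat.floor_le h0
      have h2 := Nat.lt_floor_add_one ((φ i F + a i) / (2 * η))
      rw [le_div_iff₀ (by positivity)] at h1
      rw [div_lt_iff₀ (by positivity)] at h2
      refine mul_le_mul ?_ (he i hi) (norm_nonneg _) hη.le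
      rw [Real.norm_eq_abs, abs_le]
      constructor <;> nlinarith

/-- A set containing a full grid of step `δ > 2ε` in a biorthogonal system with contractive
coefficient functionals needs at least as many `ε`-balls as there are grid points. -/
lemma prod_le_externalCoveringNumber [DecidableEq ι] (s : Finset ι) (e : ι → X) (φ : ι → X →L[ℝ] ℝ) (K : Set X)
    (hφ : ∀ i F, |φ i F| ≤ ‖F‖)
    (hφe : ∀ i ∈ s, ∀ j ∈ s, φ i (e j) = if i = j then 1 else 0) (M : ι → ℕ) {δ ε : ℝ}
    (hε : 0 ≤ ε) (hδ : 2 * ε < δ)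
    (hK : ∀ m : ι → ℕ, (∀ i ∈ s, m i ≤ M i) → ∑ i ∈ s, (δ * m i) • e i ∈ K) :
    ((∏ i ∈ s, (M i + 1) : ℕ) : ℕ∞) ≤ Metric.externalCoveringNumber ε.toNNReal K := by
  have : DecidableEq X := Classical.decEq X
  refine le_trans ?_ (Metric.packingNumber_two_mul_le_externalCoveringNumber ε.toNNReal K)
  set P := s.pi fun i => Finset.range (M i + 1) with hP
  let ext : (∀ i ∈ s, ℕ) → ι → ℕ := fun m i => if h : i ∈ s then m i h else 0
  let v : (∀ i ∈ s, ℕ) → X := fun m => ∑ i ∈ s, (δ * ext m i) • e i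
  have hφv : ∀ m, ∀ i ∈ s, φ i (v m) = δ * ext m i := by
    intro m i hi
    simp only [v, map_sum, map_smul, smul_eq_mul]
    rw [Finset.sum_eq_single_of_mem i hi fun j hj hji => by rw [hφe i hi j hj, if_neg hji.symm,
      mul_zero], hφe i hi i hi, if_pos rfl, mul_one]
  have hsep : ∀ m m', m ≠ m' → 2 * ε < ‖v m - v m'‖ := by
    intro m m' hne
    obtain ⟨i, hi, hmi⟩ : ∃ i, ∃ hi : i ∈ s, m i hi ≠ m' i hi := by
      by_contra! h
      exact hne (funext fun i => funext fun hi => h i hi)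
    refine lt_of_lt_of_le ?_ (hφ i _)
    rw [map_sub, hφv m i hi, hφv m' i hi, ← mul_sub, abs_mul, abs_of_pos (by linarith)]
    have h1 : (1 : ℝ) ≤ |(ext m i : ℝ) - ext m' i| := by
      have : (ext m i : ℤ) - ext m' i ≠ 0 := by
        simp only [ext, dif_pos hi]; omega
      exact_mod_cast Int.one_le_abs this
    nlinarith
  have hinj : Function.Injective v := by
    intro m m' h
    by_contra hne
    have := hsep m m' hne
    rw [h, sub_self, norm_zero] at this
    linarith
  have hcard : (P.image v).card = ∏ i ∈ s, (M i + 1) := by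
    rw [Finset.card_image_of_injective _ hinj, hP, Finset.card_pi]; simp
  rw [← hcard, ← Set.encard_coe_eq_coe_finsetCard]
  refine Metric.IsSeparated.encard_le_packingNumber ?_ ?_
  · intro x hx
    obtain ⟨m, hm, rfl⟩ := Finset.mem_image.1 (Finset.mem_coe.1 hx)
    refine hK _ fun i hi => ?_
    have := Finset.mem_pi.1 hm i hi
    simp only [ext, dif_pos hi]
    exact Nat.lt_succ_iff.1 (Finset.mem_range.1 this)
  · intro x hx y hy hxy
    obtain ⟨m, hm, rfl⟩ := Finset.mem_image.1 (Finset.mem_coe.1 hx)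
    obtain ⟨m', hm', rfl⟩ := Finset.mem_image.1 (Finset.mem_coe.1 hy)
    have := hsep m m' fun h => hxy (by rw [h])
    rw [edist_dist, dist_eq_norm, ENNReal.coe_mul, ENNReal.coe_ofNat, ← ENNReal.ofReal,
      ← ENNReal.ofReal_ofNat, ← ENNReal.ofReal_mul (by norm_num)]
    exact (ENNReal.ofReal_lt_ofReal_iff (by linarith)).2 this

end Abstract

/-! ### Dimensions of the homogeneous Chebyshev spaces -/

lemma card_piAntidiag_univ (Q N : ℕ) :
    (Finset.piAntidiag (Finset.univ : Finset (Fin Q)) N).card = Q.multichoose N := by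
  rw [← Finset.map_sym_eq_piAntidiag, Finset.card_map, Finset.sym_univ, Finset.card_univ,
    Sym.card_sym_eq_multichoose, Fintype.card_fin]

lemma sum_multichoose (Q n : ℕ) :
    ∑ N ∈ Finset.range (n + 1), Q.multichoose N = (n + Q).choose Q := by
  have : ∑ N ∈ Finset.range (n + 1), Q.multichoose N = (Q + 1).multichoose n := by
    induction n with
    | zero => simp
    | succ n ih => rw [Finset.sum_range_succ, ih, Nat.multichoose_succ_succ, add_comm]
  rw [this, Nat.multichoose_eq, show Q + 1 + n - 1 = n + Q by omega,
    ← Nat.choose_symm_add]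

lemma sum_mul_multichoose (Q n : ℕ) :
    (Q + 1) * ∑ N ∈ Finset.range (n + 1), N * Q.multichoose N = Q * n * (n + Q).choose Q := by
  induction n with
  | zero => simp
  | succ n ih =>
    have h1 : (n + 1 + Q).choose Q = (n + Q).choose Q + Q.multichoose (n + 1) := by
      rw [← sum_multichoose, ← sum_multichoose, Finset.sum_range_succ _ (n + 1)]
    have h2 : (n + 1) * Q.multichoose (n + 1) = Q * (n + Q).choose Q := by
      rw [Nat.multichoose_eq, show Q + (n + 1) - 1 = n + Q by omega, mul_comm,
        Nat.choose_succ_right_eq, Nat.choose_symm_add, Nat.add_sub_cancel_left, mul_comm]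
    rw [Finset.sum_range_succ, mul_add, ih, h1]
    nlinarith

lemma multichoose_le_two_pow (Q N : ℕ) : Q.multichoose N ≤ 2 ^ (N + Q) := by
  rw [Nat.multichoose_eq]
  exact (Nat.choose_le_two_pow _ _).trans (Nat.pow_le_pow_right (by norm_num) (by omega))

lemma add_pow_le_choose_mul_pow (n Q : ℕ) : (n + Q) ^ Q ≤ (n + Q).choose Q * Q ^ Q := by
  have h : ∀ k ≤ Q, (n + Q) ^ k * Q.descFactorial k ≤ (n + Q).descFactorial k * Q ^ k := by
    intro k
    induction k with
    | zero => simp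
    | succ k ih =>
      intro hk
      have h1 : (n + Q) * (Q - k) ≤ (n + Q - k) * Q := by
        obtain ⟨c, rfl⟩ := Nat.exists_eq_add_of_le hk
        rw [show k + 1 + c - k = c + 1 by omega, show n + (k + 1 + c) - k = n + c + 1 by omega]
        nlinarith
      calc _ = ((n + Q) ^ k * Q.descFactorial k) * ((n + Q) * (Q - k)) := by
            rw [Nat.descFactorial_succ]; ring
        _ ≤ ((n + Q).descFactorial k * Q ^ k) * ((n + Q - k) * Q) :=
            Nat.mul_le_mul (ih (by omega)) h1
        _ = _ := by rw [Nat.descFactorial_succ]; ring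
  have := h Q le_rfl
  rw [Nat.descFactorial_self, Nat.descFactorial_eq_factorial_mul_choose] at this
  refine Nat.le_of_mul_le_mul_left ?_ (Nat.factorial_pos Q)
  linarith

/-! ### Entropy estimates for the class in terms of the radii -/

variable {τ : ℝ}

lemma rpow_half_le (Q N : ℕ) : (N : ℝ) ^ ((Q : ℝ) / 2) ≤ Q.factorial * Real.exp N := by
  have hf : (1 : ℝ) ≤ Q.factorial := by exact_mod_cast Nat.one_le_iff_ne_zero.2 Q.factorial_ne_zero
  rcases Nat.eq_zero_or_pos N with rfl | hN
  · have : ((0 : ℕ) : ℝ) ^ ((Q : ℝ) / 2) ≤ 1 :=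
      Real.rpow_le_one (by simp) (by simp) (by positivity)
    simpa using this.trans hf
  · have h1 : (1 : ℝ) ≤ N := by exact_mod_cast hN
    have h2 := Real.pow_div_factorial_le_exp (N : ℝ) (by positivity) Q
    rw [div_le_iff₀ (by positivity)] at h2
    calc (N : ℝ) ^ ((Q : ℝ) / 2) ≤ (N : ℝ) ^ (Q : ℝ) :=
          Real.rpow_le_rpow_of_exponent_le h1 (by linarith [Nat.cast_nonneg (α := ℝ) Q])
      _ = (N : ℝ) ^ Q := Real.rpow_natCast _ _
      _ ≤ _ := by linarith

lemma summable_radius (Q : ℕ) (hτ : 0 ≤ τ) : Summable (radius Q τ) := by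
  have h := (Real.summable_pow_div_factorial (Real.exp 1 * τ)).mul_left
    ((2 * Real.pi / Q) ^ ((Q : ℝ) / 2) * Q.factorial)
  refine Summable.of_nonneg_of_le (radius_nonneg hτ) (fun N => ?_) h
  unfold radius
  rw [mul_pow, ← Real.exp_nat_mul, mul_one]
  calc _ ≤ (2 * Real.pi / Q) ^ ((Q : ℝ) / 2) * (Q.factorial * Real.exp N) * (τ ^ N / N.factorial) := by
        gcongr; exact rpow_half_le Q N
    _ = _ := by ring

lemma chebyshevCoeff_sum (hr : ∀ j, 0 < r j) (s : Finset (Fin Q → ℕ)) (c : (Fin Q → ℕ) → ℝ)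
    (l : Fin Q → ℕ) :
    chebyshevCoeff r (∑ k ∈ s, c k • chebyshevVec hr k : Lp ℝ ∞ (boxMeasure r)) l =
      if l ∈ s then c l else 0 := by
  rw [← coeffFunctional_apply hr, map_sum]
  simp only [map_smul, coeffFunctional_apply, chebyshevCoeff_chebyshevVec, smul_eq_mul, mul_ite,
    mul_one, mul_zero]
  rw [Finset.sum_ite_eq]

lemma mem_piAntidiag_univ {k : Fin Q → ℕ} {N : ℕ} :
    k ∈ Finset.piAntidiag Finset.univ N ↔ ∑ j, k j = N := by
  simp

lemma chebyshevCoeff_componentVec (hr : ∀ j, 0 < r j) (N : ℕ) (F : Lp ℝ ∞ (boxMeasure r))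
    (l : Fin Q → ℕ) :
    chebyshevCoeff r (componentVec hr N F) l = if N = ∑ j, l j then chebyshevCoeff r F l else 0 := by
  rw [componentVec, chebyshevCoeff_sum]
  simp only [mem_piAntidiag_univ, eq_comm]

/-- Elements of the class are the sums, in `L∞`, of their homogeneous components. -/
lemma hasSum_componentVec (hr : ∀ j, 0 < r j) (hτ : 0 ≤ τ) {F : Lp ℝ ∞ (boxMeasure r)}
    (hF : F ∈ entireClass τ r) : HasSum (fun N => componentVec hr N F) F := by
  rw [mem_entireClass_iff hr hτ] at hF
  have hs : Summable fun N => componentVec hr N F :=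
    Summable.of_norm_bounded (summable_radius Q hτ) hF
  have h0 : F - ∑' N, componentVec hr N F = 0 := by
    refine eq_zero_of_chebyshevCoeff_eq_zero hr fun k => ?_
    rw [← coeffFunctional_apply hr, map_sub, ContinuousLinearMap.map_tsum _ hs]
    simp only [coeffFunctional_apply, chebyshevCoeff_componentVec]
    rw [tsum_ite_eq, sub_self]
  rw [sub_eq_zero] at h0
  have h := hs.hasSum
  rwa [← h0] at h

lemma norm_sub_sum_componentVec_le (hr : ∀ j, 0 < r j) (hτ : 0 ≤ τ) {F : Lp ℝ ∞ (boxMeasure r)}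
    (hF : F ∈ entireClass τ r) (n : ℕ) :
    ‖F - ∑ N ∈ Finset.range n, componentVec hr N F‖ ≤ ∑' j, radius Q τ (j + n) := by
  have h := hasSum_componentVec hr hτ hF
  have he := h.summable.sum_add_tsum_nat_add n
  rw [h.tsum_eq] at he
  rw [sub_eq_of_eq_add' he.symm]
  exact tsum_of_norm_bounded ((summable_nat_add_iff n).2 (summable_radius Q hτ)).hasSum
    fun j => (mem_entireClass_iff hr hτ).1 hF _

lemma abs_chebyshevCoeff_le_radius (hr : ∀ j, 0 < r j) (hτ : 0 ≤ τ)
    {F : Lp ℝ ∞ (boxMeasure r)} (hF : F ∈ entireClass τ r) (k : Fin Q → ℕ) :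
    |chebyshevCoeff r F k| ≤ radius Q τ (∑ j, k j) := by
  have h := chebyshevCoeff_componentVec hr (∑ j, k j) F k
  rw [if_pos rfl] at h
  rw [← h]
  exact (abs_chebyshevCoeff_le hr k _).trans ((mem_entireClass_iff hr hτ).1 hF _)

/-- The multi-indices of degree at most `n`, graded by degree. -/
def gradedIndex (Q n : ℕ) : Finset (Σ _ : ℕ, Fin Q → ℕ) :=
  (Finset.range (n + 1)).sigma fun N => Finset.piAntidiag Finset.univ N

lemma card_gradedIndex (Q n : ℕ) : (gradedIndex Q n).card = (n + Q).choose Q := by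
  rw [gradedIndex, Finset.card_sigma, ← sum_multichoose]
  exact Finset.sum_congr rfl fun N _ => card_piAntidiag_univ Q N

lemma exists_isCover_entireClass (hr : ∀ j, 0 < r j) (hτ : 0 ≤ τ) {ε : ℝ} (hε : 0 < ε) {n : ℕ}
    (ht : ∑' j, radius Q τ (j + (n + 1)) ≤ ε / 2) :
    ∃ C : Finset (Lp ℝ ∞ (boxMeasure r)),
      C.card ≤ ∏ i ∈ gradedIndex Q n,
        (⌊radius Q τ i.1 / (ε / (2 * √2 ^ Q * (n + Q).choose Q))⌋₊ + 1) ∧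
      Metric.IsCover ε.toNNReal (entireClass τ r) (C : Set (Lp ℝ ∞ (boxMeasure r))) := by
  have hc : (0 : ℝ) < (n + Q).choose Q := by
    exact_mod_cast Nat.choose_pos (Nat.le_add_left Q n)
  refine exists_isCover_of_coeff_bound (gradedIndex Q n) (fun i => chebyshevVec hr i.2)
    (fun i F => chebyshevCoeff r F i.2) (entireClass τ r) (fun i => radius Q τ i.1)
    (b := √2 ^ Q) (t := ε / 2) (by positivity) (fun i _ => norm_chebyshevVec_le hr _)
    (fun F hF i hi => ?_) (fun F hF => ?_) (le_of_eq ?_)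
  · have := (Finset.mem_sigma.1 hi).2
    rw [mem_piAntidiag_univ] at this
    rw [← this]
    exact abs_chebyshevCoeff_le_radius hr hτ hF _
  · rw [gradedIndex, Finset.sum_sigma]
    exact (norm_sub_sum_componentVec_le hr hτ hF (n + 1)).trans ht
  · rw [card_gradedIndex]
    field_simp
    ring

lemma isCompact_entireClass (hr : ∀ j, 0 < r j) (hτ : 0 ≤ τ) : IsCompact (entireClass τ r) := by
  refine TotallyBounded.isCompact_of_isClosed ?_ (isClosed_entireClass hr hτ)
  rw [Metric.totallyBounded_iff]
  intro ε hε
  obtain ⟨n, hn⟩ : ∃ n, ∑' j, radius Q τ (j + n) < ε / 2 / 2 :=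
    ((tendsto_sum_nat_add (radius Q τ)).eventually_lt_const (by positivity)).exists
  obtain ⟨n, hn⟩ : ∃ n, ∑' j, radius Q τ (j + (n + 1)) ≤ ε / 2 / 2 := by
    refine ⟨n, le_trans ?_ hn.le⟩
    have hs := (summable_nat_add_iff n).2 (summable_radius Q hτ)
    rw [hs.tsum_eq_zero_add]
    simp only [add_assoc, add_comm 1 n]
    linarith [radius_nonneg (Q := Q) hτ (0 + n)]
  obtain ⟨C, -, hC⟩ := exists_isCover_entireClass hr hτ (half_pos hε) hn
  refine ⟨C, C.finite_toSet, ?_⟩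
  rw [Metric.isCover_iff_subset_iUnion_closedBall] at hC
  refine hC.trans (Set.iUnion₂_mono fun y _ => Metric.closedBall_subset_ball ?_)
  rw [Real.coe_toNNReal _ (by positivity)]
  linarith

lemma externalCoveringNumber_ne_top (hr : ∀ j, 0 < r j) (hτ : 0 ≤ τ) {ε : ℝ} (hε : 0 < ε) :
    Metric.externalCoveringNumber ε.toNNReal (entireClass τ r) ≠ ⊤ := by
  obtain ⟨t, htf, hc⟩ :=
    Metric.totallyBounded_iff.1 (isCompact_entireClass hr hτ).totallyBounded ε hε
  have hcov : Metric.IsCover ε.toNNReal (entireClass τ r) t := by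
    rw [Metric.isCover_iff_subset_iUnion_closedBall]
    refine hc.trans (Set.iUnion₂_mono fun y _ => ?_)
    rw [Real.coe_toNNReal _ hε.le]
    exact Metric.ball_subset_closedBall
  exact ne_top_of_le_ne_top (Set.encard_ne_top_iff.2 htf) hcov.externalCoveringNumber_le_encard

/-- Upper entropy estimate by rounding the coefficients of degree at most `n`. -/
lemma entropy_le (hr : ∀ j, 0 < r j) (hτ : 0 ≤ τ) {ε Y : ℝ} (hε : 0 < ε) {n : ℕ}
    (ht : ∑' j, radius Q τ (j + (n + 1)) ≤ ε / 2)
    (hY : ∀ N ≤ n, radius Q τ N * (2 * √2 ^ Q * (n + Q).choose Q) / ε + 1 ≤ Y) :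
    entropy ε (entireClass τ r) ≤ (n + Q).choose Q * Real.log Y := by
  obtain ⟨C, hC, hcov⟩ := exists_isCover_entireClass hr hτ hε ht
  have hY1 : 1 ≤ Y := by
    refine le_trans ?_ (hY 0 (Nat.zero_le _))
    have := radius_nonneg (Q := Q) hτ 0
    have : 0 ≤ radius Q τ 0 * (2 * √2 ^ Q * (n + Q).choose Q) / ε := by positivity
    linarith
  have h1 := hcov.externalCoveringNumber_le_encard
  rw [Set.encard_coe_eq_coe_finsetCard] at h1
  have h2 : (Metric.externalCoveringNumber ε.toNNReal (entireClass τ r)).toNat ≤ C.card :=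
    ENat.toNat_le_of_le_natCast h1
  have h3 : ((∏ i ∈ gradedIndex Q n,
      (⌊radius Q τ i.1 / (ε / (2 * √2 ^ Q * (n + Q).choose Q))⌋₊ + 1) : ℕ) : ℝ) ≤
        Y ^ (n + Q).choose Q := by
    rw [← card_gradedIndex Q n, Nat.cast_prod, ← Finset.prod_const, card_gradedIndex]
    refine Finset.prod_le_prod (fun i _ => by positivity) fun i hi => ?_
    have hi' := Finset.mem_range.1 (Finset.mem_sigma.1 hi).1
    refine le_trans ?_ (hY i.1 (by omega))
    have h0 := radius_nonneg (Q := Q) hτ i.1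
    push_cast
    refine add_le_add_left ((Nat.floor_le (by positivity)).trans (le_of_eq ?_)) 1
    rw [div_div_eq_mul_div]
  have h4 : ((Metric.externalCoveringNumber ε.toNNReal (entireClass τ r)).toNat : ℝ) ≤
      Y ^ (n + Q).choose Q := le_trans (by exact_mod_cast h2.trans hC) h3
  rw [entropy, ← Real.log_pow]
  rcases Nat.eq_zero_or_pos (Metric.externalCoveringNumber ε.toNNReal (entireClass τ r)).toNat
    with h0 | h0
  · rw [h0, Nat.cast_zero, Real.log_zero]
    exact Real.log_nonneg (one_le_pow₀ hY1)
  · exact Real.log_le_log (by exact_mod_cast h0) h4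

/-- Lower entropy estimate by a grid of coefficients of degree at most `n`: the degree-`N` part of
such an element has norm at most `√2 ^ Q` times the sum of the absolute values of its
coefficients. -/
lemma le_entropy (hr : ∀ j, 0 < r j) (hτ : 0 ≤ τ) {ε : ℝ} (hε : 0 < ε) (n : ℕ) (g : ℕ → ℝ)
    (hg : ∀ N ≤ n, Real.exp (g N) ≤
      max 1 (radius Q τ N / (3 * ε * √2 ^ Q * Q.multichoose N))) :
    ∑ N ∈ Finset.range (n + 1), Q.multichoose N * g N ≤ entropy ε (entireClass τ r) := by
  set M : ℕ → ℕ := fun N => ⌊radius Q τ N / (3 * ε * √2 ^ Q * Q.multichoose N)⌋₊ with hM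
  have hgM : ∀ N ≤ n, g N ≤ Real.log (M N + 1) := by
    intro N hN
    rw [Real.le_log_iff_exp_le (by positivity)]
    refine (hg N hN).trans (max_le ?_ (Nat.lt_floor_add_one _).le)
    linarith [Nat.cast_nonneg (α := ℝ) (M N)]
  have key := prod_le_externalCoveringNumber (gradedIndex Q n) (fun i => chebyshevVec hr i.2)
    (fun i => coeffFunctional hr i.2) (entireClass τ r)
    (fun i F => abs_chebyshevCoeff_le hr i.2 F) (fun i hi j hj => ?_) (fun i => M i.1)
    (δ := 3 * ε) hε.le (by linarith) fun m hm => ?_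
  · have hfin := externalCoveringNumber_ne_top hr hτ hε (τ := τ) (r := r)
    have h1 : ((∏ i ∈ gradedIndex Q n, (M i.1 + 1) : ℕ) : ℝ) ≤
        ((Metric.externalCoveringNumber ε.toNNReal (entireClass τ r)).toNat : ℝ) := by
      rw [← ENat.natCast_toNat hfin] at key
      exact_mod_cast key
    refine le_trans ?_ (Real.log_le_log (by positivity) h1)
    rw [Nat.cast_prod, Real.log_prod fun i _ => by positivity, gradedIndex, Finset.sum_sigma]
    refine Finset.sum_le_sum fun N hN => ?_
    change _ ≤ ∑ _k ∈ Finset.piAntidiag (Finset.univ : Finset (Fin Q)) N, Real.log ((M N + 1 : ℕ) : ℝ)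
    rw [Finset.sum_const, card_piAntidiag_univ, nsmul_eq_mul]
    push_cast
    exact mul_le_mul_of_nonneg_left (hgM N (by simpa [Nat.lt_succ_iff] using hN)) (by positivity)
  · have hi' := mem_piAntidiag_univ.1 (Finset.mem_sigma.1 hi).2
    have hj' := mem_piAntidiag_univ.1 (Finset.mem_sigma.1 hj).2
    rw [coeffFunctional_apply, chebyshevCoeff_chebyshevVec]
    refine if_congr ⟨fun h => ?_, fun h => by rw [h]⟩ rfl rfl
    obtain ⟨a, k⟩ := i
    obtain ⟨b, l⟩ := j
    simp only at h hi' hj'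
    subst h; subst hi'; subst hj'; rfl
  · rw [mem_entireClass_iff hr hτ]
    intro N
    rw [gradedIndex, Finset.sum_sigma]
    have hcomp : componentVec hr N (∑ N ∈ Finset.range (n + 1),
        ∑ k ∈ Finset.piAntidiag Finset.univ N,
          (3 * ε * (m ⟨N, k⟩ : ℝ)) • chebyshevVec hr k) =
        if N ≤ n then ∑ k ∈ Finset.piAntidiag Finset.univ N,
          (3 * ε * (m ⟨N, k⟩ : ℝ)) • chebyshevVec hr k else 0 := by
      have hc : ∀ l ∈ Finset.piAntidiag (Finset.univ : Finset (Fin Q)) N,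
          chebyshevCoeff r (∑ N ∈ Finset.range (n + 1),
            ∑ k ∈ Finset.piAntidiag Finset.univ N,
              (3 * ε * (m ⟨N, k⟩ : ℝ)) • chebyshevVec hr k : Lp ℝ ∞ (boxMeasure r)) l =
            if N ≤ n then 3 * ε * (m ⟨N, l⟩ : ℝ) else 0 := by
        intro l hl
        rw [mem_piAntidiag_univ] at hl
        rw [← coeffFunctional_apply hr, map_sum]
        simp only [coeffFunctional_apply]
        simp_rw [chebyshevCoeff_sum hr _ (fun k => 3 * ε * (m ⟨_, k⟩ : ℝ)), mem_piAntidiag_univ, hl]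
        rw [Finset.sum_ite_eq]
        simp
      rw [componentVec, Finset.sum_congr rfl fun l hl => by rw [hc l hl]]
      split_ifs <;> simp
    rw [hcomp]
    split_ifs with hNn
    · refine (norm_sum_le _ _).trans
        ((Finset.sum_le_card_nsmul _ _ (3 * ε * (M N : ℝ) * √2 ^ Q) fun k hk => ?_).trans ?_)
      · rw [norm_smul, Real.norm_of_nonneg (by positivity)]
        have hm' : (m ⟨N, k⟩ : ℝ) ≤ M N := by
          exact_mod_cast hm ⟨N, k⟩ (Finset.mem_sigma.2 ⟨by simpa [Nat.lt_succ_iff] using hNn, hk⟩)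
        have := norm_chebyshevVec_le hr k
        gcongr
      · rw [card_piAntidiag_univ, nsmul_eq_mul]
        have h0 := radius_nonneg (Q := Q) hτ N
        rcases Nat.eq_zero_or_pos (Q.multichoose N) with hd | hd
        · rw [hd]; simpa using h0
        · have hd' : (0 : ℝ) < Q.multichoose N := by exact_mod_cast hd
          have h := Nat.floor_le (a := radius Q τ N / (3 * ε * √2 ^ Q * Q.multichoose N))
            (by positivity)
          rw [le_div_iff₀ (by positivity)] at h
          calc _ = (M N : ℝ) * (3 * ε * √2 ^ Q * Q.multichoose N) := by ring
            _ ≤ _ := h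
    · simpa using radius_nonneg hτ N

/-! ### The explicit upper estimate -/

lemma rpow_eq_exp {a b : ℝ} (ha : 0 < a) : a ^ b = Real.exp (b * Real.log a) := by
  rw [Real.rpow_def_of_pos ha, mul_comm]

lemma pow_div_factorial_eq {τ : ℝ} (hτ : 0 < τ) (N : ℕ) :
    τ ^ N / (N.factorial : ℝ) = Real.exp (N * Real.log τ - Real.log N.factorial) := by
  rw [Real.exp_sub, Real.exp_log (by positivity), ← Real.log_pow, Real.exp_log (by positivity)]

lemma radius_eq_exp (hQ : 0 < Q) (hτ : 0 < τ) {N : ℕ} (hN : 0 < N) :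
    radius Q τ N = Real.exp ((Q : ℝ) / 2 * Real.log (2 * Real.pi / Q) + (Q : ℝ) / 2 * Real.log N +
      (N * Real.log τ - Real.log N.factorial)) := by
  have hQ' : (0 : ℝ) < Q := by exact_mod_cast hQ
  have hN' : (0 : ℝ) < N := by exact_mod_cast hN
  have := Real.pi_pos
  rw [radius, rpow_eq_exp (by positivity), rpow_eq_exp hN', pow_div_factorial_eq hτ, Real.exp_add,
    Real.exp_add]

lemma mul_log_sub_le_log_factorial {N : ℕ} (hN : 0 < N) :
    N * Real.log N - N ≤ Real.log N.factorial := by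
  have hN' : (0 : ℝ) < N := by exact_mod_cast hN
  have h := Real.pow_div_factorial_le_exp (N : ℝ) hN'.le N
  have h2 := Real.log_le_log (by positivity) h
  rw [Real.log_exp, Real.log_div (by positivity) (by positivity), Real.log_pow] at h2
  linarith

lemma log_factorial_le_mul_log (N : ℕ) : Real.log N.factorial ≤ N * Real.log N := by
  rw [← Real.log_pow]
  exact Real.log_le_log (by positivity) (by exact_mod_cast Nat.factorial_le_pow N)

lemma radius_zero (hQ : 0 < Q) (τ : ℝ) : radius Q τ 0 = 0 := by
  have hQ' : (0 : ℝ) < Q := by exact_mod_cast hQ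
  rw [radius, Nat.cast_zero, Real.zero_rpow (by positivity)]
  simp

lemma log_eq_of_upperB (hQ : 0 < Q) (hτ : 0 < τ) {ε : ℝ} (hε : 0 < ε) :
    Real.log ε = Real.log 4 + (Q : ℝ) / 2 * (Real.log (2 * Real.pi / Q) + (1 + Real.log τ)) -
      upperB Q τ ε := by
  have hQ' : (0 : ℝ) < Q := by exact_mod_cast hQ
  have := Real.pi_pos
  have h1 : 2 * Real.exp 1 * Real.pi * τ / Q = (2 * Real.pi / Q) * (Real.exp 1 * τ) := by ring
  rw [upperB, Real.log_div (by norm_num) hε.ne', h1, Real.log_mul (by positivity) (by positivity),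
    Real.log_mul (by positivity) hτ.ne', Real.log_exp]
  ring

lemma log_le_two_sqrt_div_exp {y : ℝ} (hy : 0 < y) : Real.log y ≤ 2 * √y / Real.exp 1 := by
  have hs : 0 < √y := Real.sqrt_pos.2 hy
  have h := Real.log_le_sub_one_of_pos (x := √y / Real.exp 1) (by positivity)
  rw [Real.log_div hs.ne' (by positivity), Real.log_exp, Real.log_sqrt hy.le] at h
  have : 2 * √y / Real.exp 1 = 2 * (√y / Real.exp 1) := by ring
  linarith

lemma quotD_eq (hτ : 0 < τ) {B : ℝ} (hB : 0 < B) :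
    quotD τ B = B / Real.log (B / (Real.exp 1 * τ)) := by
  rw [quotD, Real.log_div hB.ne' (by positivity)]

/-- Truncation beyond degree `2 D(B) + Q / 2` makes the index so large that
`log (N / (eτ)) ≥ 1 + log (B / (eτ)) / 2`. -/
lemma one_add_half_log_le (hτ : 0 < τ) {B : ℝ} (hB : Real.exp 2 * τ ≤ B) {x : ℝ}
    (hx : 2 * quotD τ B ≤ x) :
    1 + Real.log (B / (Real.exp 1 * τ)) / 2 ≤ Real.log x - (1 + Real.log τ) := by
  have hB0 : 0 < B := lt_of_lt_of_le (by positivity) hB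
  have he := Real.exp_pos 1
  set y := B / (Real.exp 1 * τ) with hy
  have hy0 : 0 < y := by positivity
  have hye : Real.exp 1 ≤ y := by
    rw [hy, le_div_iff₀ (by positivity)]
    have : Real.exp 1 * (Real.exp 1 * τ) = Real.exp 2 * τ := by
      rw [← mul_assoc, ← Real.exp_add]; norm_num
    linarith
  have hly : 1 ≤ Real.log y := by rw [Real.le_log_iff_exp_le hy0]; exact hye
  have hD : quotD τ B = B / Real.log y := quotD_eq hτ hB0
  have hs := log_le_two_sqrt_div_exp hy0
  have hs0 : 0 < √y := Real.sqrt_pos.2 hy0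
  have h1 : Real.exp 1 * √y * (Real.exp 1 * τ) ≤ x := by
    refine le_trans ?_ hx
    rw [hD, mul_div_assoc', le_div_iff₀ (by linarith)]
    have hBy : B = √y * √y * (Real.exp 1 * τ) := by
      rw [Real.mul_self_sqrt hy0.le, hy]; field_simp
    rw [le_div_iff₀ he] at hs
    calc Real.exp 1 * √y * (Real.exp 1 * τ) * Real.log y
        = (√y * (Real.exp 1 * τ)) * (Real.log y * Real.exp 1) := by ring
      _ ≤ (√y * (Real.exp 1 * τ)) * (2 * √y) := by gcongr
      _ = 2 * B := by rw [hBy]; ring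
  have h2 := Real.log_le_log (by positivity) h1
  rw [Real.log_mul (by positivity) (by positivity), Real.log_mul he.ne' hs0.ne',
    Real.log_mul he.ne' hτ.ne', Real.log_exp, Real.log_sqrt hy0.le] at h2
  linarith

lemma one_le_log_of_le (hτ : 0 < τ) {B : ℝ} (hB : Real.exp 2 * τ ≤ B) :
    1 ≤ Real.log (B / (Real.exp 1 * τ)) := by
  have hB0 : 0 < B := lt_of_lt_of_le (by positivity) hB
  rw [Real.le_log_iff_exp_le (by positivity), le_div_iff₀ (by positivity), ← mul_assoc,
    ← Real.exp_add]
  norm_num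
  exact hB

lemma tsum_radius_le (hQ : 0 < Q) (hτ : 1 ≤ τ) {ε : ℝ} (hε : 0 < ε)
    (hB : Real.exp 2 * τ ≤ upperB Q τ ε) :
    ∑' j, radius Q τ (j + (⌊2 * quotD τ (upperB Q τ ε) + (Q : ℝ) / 2⌋₊ + 1)) ≤ ε / 2 := by
  have hτ0 : 0 < τ := by linarith
  have hQ' : (0 : ℝ) < Q := by exact_mod_cast hQ
  set B := upperB Q τ ε with hBdef
  have hB0 : 0 < B := lt_of_lt_of_le (by positivity) hB
  have hly := one_le_log_of_le hτ0 hB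
  set D := quotD τ B with hDdef
  have hDy : D * Real.log (B / (Real.exp 1 * τ)) = B := by
    rw [hDdef, quotD_eq hτ0 hB0, div_mul_cancel₀ _ (by linarith)]
  have hD0 : 0 < D := by
    rw [hDdef, quotD_eq hτ0 hB0]; exact div_pos hB0 (by linarith)
  have hbound : ∀ j : ℕ, radius Q τ (j + (⌊2 * D + (Q : ℝ) / 2⌋₊ + 1)) ≤ ε / 4 * (1 / 2) ^ j := by
    intro j
    set N := j + (⌊2 * D + (Q : ℝ) / 2⌋₊ + 1) with hN
    have hN0 : 0 < N := by omega
    have hN1 : 2 * D + (Q : ℝ) / 2 + j ≤ N := by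
      have := (Nat.lt_floor_add_one (2 * D + (Q : ℝ) / 2)).le
      rw [hN]; push_cast; linarith
    have hj : (0 : ℝ) ≤ j := Nat.cast_nonneg j
    have hlog := one_add_half_log_le hτ0 hB (x := N) (by linarith)
    have hfac := mul_log_sub_le_log_factorial hN0
    have hhalf : Real.exp (-(j : ℝ)) ≤ (1 / 2) ^ j := by
      rw [show -(j : ℝ) = j * (-1) by ring, Real.exp_nat_mul]
      refine pow_le_pow_left₀ (Real.exp_pos _).le ?_ j
      rw [Real.exp_neg, one_div]
      exact inv_anti₀ (by norm_num) (by linarith [Real.add_one_le_exp (1 : ℝ)])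
    refine le_trans ?_ (mul_le_mul_of_nonneg_left hhalf (by positivity))
    have hε4 : ε / 4 = Real.exp (Real.log ε - Real.log 4) := by
      rw [Real.exp_sub, Real.exp_log hε, Real.exp_log (by norm_num)]
    rw [hε4, ← Real.exp_add, radius_eq_exp hQ hτ0 hN0, Real.exp_le_exp,
      log_eq_of_upperB hQ hτ0 hε, ← hBdef]
    have hprod := mul_le_mul (show 2 * D + j ≤ (N : ℝ) - Q / 2 by linarith) hlog
      (by linarith) (by linarith)
    have h3 : 2 * D + j ≤ (2 * D + j) * 1 := by linarith
    have h4 : (j : ℝ) * 0 ≤ j * (Real.log (B / (Real.exp 1 * τ)) / 2) := by gcongr; linarith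
    nlinarith
  have hsum : Summable fun j : ℕ => ε / 4 * (1 / 2 : ℝ) ^ j :=
    (summable_geometric_of_lt_one (by norm_num) (by norm_num)).mul_left _
  refine (Summable.tsum_le_tsum hbound
    ((summable_nat_add_iff _).2 (summable_radius Q hτ0.le)) hsum).trans ?_
  rw [tsum_mul_left, tsum_geometric_of_lt_one (by norm_num) (by norm_num)]
  apply le_of_eq
  ring

/-- Explicit upper estimate: the truncation degree is `⌊2 D(B₊) + Q / 2⌋`, and the second factor
bounds the logarithm of the number of grid values of each coefficient. -/
lemma entropy_le_quotD_upperB (hr : ∀ j, 0 < r j) (hQ : 6 ≤ Q) (hτ : 1 ≤ τ) {ε : ℝ} (hε : 0 < ε)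
    (hB : Real.exp 2 * τ ≤ upperB Q τ ε) :
    entropy ε (entireClass τ r) ≤
      (2 * quotD τ (upperB Q τ ε) + 3 * Q / 2) ^ Q / Q.factorial *
        (upperB Q τ ε + τ + (Q : ℝ) / 2 *
          (Real.log (2 * quotD τ (upperB Q τ ε) + (Q : ℝ) / 2) - 1) +
          (1 + 3 * Q / 2 + (2 * quotD τ (upperB Q τ ε) + (Q : ℝ) / 2)) * Real.log 2) := by
  have hτ0 : 0 < τ := by linarith
  have hQ0 : 0 < Q := by omega
  have hQ6 : (6 : ℝ) ≤ Q := by exact_mod_cast hQ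
  have ht := tsum_radius_le hQ0 hτ hε hB
  set B := upperB Q τ ε with hBdef
  have hB0 : 0 < B := lt_of_lt_of_le (by positivity) hB
  have hB1 : 1 ≤ B := by
    have : (1 : ℝ) ≤ Real.exp 2 := by linarith [Real.add_one_le_exp (2 : ℝ)]
    nlinarith
  have hly := one_le_log_of_le hτ0 hB
  set D := quotD τ B with hDdef
  have hD0 : 0 < D := by
    rw [hDdef, quotD_eq hτ0 hB0]; exact div_pos hB0 (by linarith)
  set M := 2 * D + (Q : ℝ) / 2 with hM
  set n := ⌊M⌋₊ with hn
  have hM0 : 3 ≤ M := by rw [hM]; linarith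
  have hnM : (n : ℝ) ≤ M := Nat.floor_le (by linarith)
  have hl2 : 0 < Real.log 2 := Real.log_pos (by norm_num)
  have hlM : 1 ≤ Real.log M := by
    rw [Real.le_log_iff_exp_le (by linarith)]
    linarith [Real.exp_one_lt_d9]
  have hlτ : 0 ≤ Real.log τ := Real.log_nonneg hτ
  set X := B + τ + (Q : ℝ) / 2 * (Real.log M - 1) + (1 + 3 * Q / 2 + M) * Real.log 2 with hX
  have hX1 : 1 ≤ X := by
    have h1 : 0 ≤ (Q : ℝ) / 2 * (Real.log M - 1) := mul_nonneg (by positivity) (by linarith)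
    have h2 : 0 ≤ (1 + 3 * Q / 2 + M) * Real.log 2 := by positivity
    rw [hX]; linarith
  have hexp2 : (2 : ℝ) ≤ Real.exp X := by linarith [Real.add_one_le_exp X]
  have hchoose : ((n + Q).choose Q : ℝ) ≤ Real.exp ((M + Q) * Real.log 2) := by
    have h1 : ((n + Q).choose Q : ℝ) ≤ 2 ^ (n + Q) := by exact_mod_cast Nat.choose_le_two_pow _ _
    refine h1.trans ?_
    rw [← Real.exp_log (show (0 : ℝ) < 2 ^ (n + Q) by positivity), Real.log_pow, Real.exp_le_exp]
    push_cast
    gcongr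
  have h := entropy_le hr hτ0.le (Y := Real.exp X) hε ht fun N hN => ?_
  · rw [Real.log_exp] at h
    refine h.trans (mul_le_mul_of_nonneg_right ?_ (by linarith))
    refine (Nat.choose_le_pow_div Q (n + Q)).trans ?_
    gcongr
    push_cast
    linarith
  · rcases Nat.eq_zero_or_pos N with rfl | hN0
    · rw [radius_zero hQ0]; simp; linarith
    · have hNr : (0 : ℝ) < N := by exact_mod_cast hN0
      have hNM : (N : ℝ) ≤ M := le_trans (by exact_mod_cast hN) hnM
      have hlN : Real.log N ≤ Real.log M := Real.log_le_log hNr hNM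
      have hfac := mul_log_sub_le_log_factorial hN0
      -- `N log (eτ / N) ≤ τ`
      have hNτ : N * Real.log τ + N - N * Real.log N ≤ τ := by
        have h1 := Real.log_le_sub_one_of_pos (x := τ / N) (by positivity)
        rw [Real.log_div hτ0.ne' hNr.ne'] at h1
        have h2 := mul_le_mul_of_nonneg_left h1 hNr.le
        rw [mul_sub (N : ℝ) (τ / N), mul_div_cancel₀ _ hNr.ne'] at h2
        linarith
      have hsq : √2 ^ Q = Real.exp ((Q : ℝ) / 2 * Real.log 2) := by
        rw [← Real.exp_log (show (0 : ℝ) < √2 ^ Q by positivity), Real.log_pow,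
          Real.log_sqrt (by norm_num)]
        ring_nf
      have h2e : (2 : ℝ) = Real.exp (Real.log 2) := (Real.exp_log (by norm_num)).symm
      have hmain : radius Q τ N * (2 * √2 ^ Q * (n + Q).choose Q) / ε ≤
          Real.exp (X - Real.log 4) := by
        rw [div_le_iff₀ hε]
        calc radius Q τ N * (2 * √2 ^ Q * (n + Q).choose Q)
            ≤ radius Q τ N * (2 * √2 ^ Q * Real.exp ((M + Q) * Real.log 2)) :=
              mul_le_mul_of_nonneg_left (mul_le_mul_of_nonneg_left hchoose (by positivity))
                (radius_nonneg hτ0.le N)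
          _ = Real.exp ((Q : ℝ) / 2 * Real.log (2 * Real.pi / Q) + (Q : ℝ) / 2 * Real.log N +
                (N * Real.log τ - Real.log N.factorial) + (Real.log 2 + (Q : ℝ) / 2 * Real.log 2 +
                  (M + Q) * Real.log 2)) := by
              rw [radius_eq_exp hQ0 hτ0 hN0, hsq, Real.exp_add _ (Real.log 2 + _ + _),
                Real.exp_add (Real.log 2 + _), Real.exp_add (Real.log 2), ← h2e]
          _ ≤ Real.exp (X - Real.log 4 + Real.log ε) := by
              rw [Real.exp_le_exp, log_eq_of_upperB hQ0 hτ0 hε, ← hBdef, hX]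
              have h5 : (Q : ℝ) / 2 * Real.log N ≤ (Q : ℝ) / 2 * Real.log M := by gcongr
              have h6 : 0 ≤ (Q : ℝ) / 2 * Real.log τ := by positivity
              linarith
          _ = Real.exp (X - Real.log 4) * ε := by rw [Real.exp_add, Real.exp_log hε]
      rw [Real.exp_sub, Real.exp_log (by norm_num : (0 : ℝ) < 4)] at hmain
      linarith

lemma pow_le_exp_pow_mul_factorial (Q : ℕ) : (Q : ℝ) ^ Q ≤ Real.exp 1 ^ Q * Q.factorial := by
  have h := Real.pow_div_factorial_le_exp (Q : ℝ) (by positivity) Q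
  rw [div_le_iff₀ (by positivity)] at h
  rwa [← Real.exp_nat_mul, mul_one]

/-- The upper bound on `τ` says that `2eπτ / Q ≤ e^{-1/2}`; for `τ ≥ 1` it forces `Q ≥ 28`. -/
lemma bounds_of_le_div (hQ : 0 < Q) (hτ : 0 < τ)
    (hτQ : τ ≤ (Q : ℝ) / (2 * Real.exp (3 / 2) * Real.pi)) :
    28 * τ ≤ Q ∧ 1 / 2 ≤ -(Real.log (2 * Real.pi / Q) + (1 + Real.log τ)) := by
  have hπ := Real.pi_gt_d2
  have hQ' : (0 : ℝ) < Q := by exact_mod_cast hQ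
  have he : Real.exp (3 / 2) ^ 2 = Real.exp 1 ^ 3 := by
    rw [← Real.exp_nat_mul, ← Real.exp_nat_mul]; norm_num
  have h1 := Real.exp_one_gt_d9
  have h3 : (20.07 : ℝ) ≤ Real.exp 1 ^ 3 := by
    have : (2.718 : ℝ) ^ 3 ≤ Real.exp 1 ^ 3 := by gcongr; linarith
    linarith
  have he2 : (4.479 : ℝ) ≤ Real.exp (3 / 2) := by
    refine le_of_sq_le_sq ?_ (Real.exp_pos _).le
    rw [he]; linarith
  rw [le_div_iff₀ (by positivity)] at hτQ
  constructor
  · have : (28 : ℝ) ≤ 2 * Real.exp (3 / 2) * Real.pi := by nlinarith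
    nlinarith
  · have h := Real.log_le_log (by positivity) hτQ
    rw [Real.log_mul hτ.ne' (by positivity), mul_right_comm,
      Real.log_mul (by positivity) (by positivity), Real.log_exp] at h
    rw [Real.log_div (by positivity) (by positivity)]
    linarith

lemma twelve_le_log (hQ : (28 : ℝ) ≤ Q) (hτ : 1 ≤ τ) :
    12 ≤ Real.log (((Q : ℝ) + 1) ^ 2 * (Real.exp 1 * τ) ^ 6) := by
  have hτ0 : 0 < τ := by linarith
  have hlτ : 0 ≤ Real.log τ := Real.log_nonneg hτ
  have h3 : 3 ≤ Real.log ((Q : ℝ) + 1) := by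
    rw [Real.le_log_iff_exp_le (by positivity)]
    have h3' : Real.exp 3 = Real.exp 1 ^ 3 := by rw [← Real.exp_nat_mul]; norm_num
    have h4 : Real.exp 1 ^ 3 ≤ 2.72 ^ 3 := by
      gcongr; linarith [Real.exp_one_lt_d9]
    rw [h3']
    linarith
  rw [Real.log_mul (by positivity) (by positivity), Real.log_pow, Real.log_pow,
    Real.log_mul (by positivity) hτ0.ne', Real.log_exp]
  push_cast
  linarith

lemma le_two_div_three_mul_sqrt : 0.265 ≤ 2 / (3 * √(2 * Real.pi)) := by
  have := Real.pi_pos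
  have h1 : √(2 * Real.pi) ≤ 2.51 := by
    rw [Real.sqrt_le_left (by norm_num)]
    linarith [Real.pi_lt_d4]
  have h2 : 0 < √(2 * Real.pi) := Real.sqrt_pos.2 (by positivity)
  rw [le_div_iff₀ (by positivity)]
  linarith

lemma pow_div_factorial_le (hQ : 0 < Q) {D : ℝ} (hD0 : 0 ≤ D) :
    (2 * D + 3 * Q / 2) ^ Q / Q.factorial ≤
    (2 * Real.exp 1 / Q) ^ Q * (D + 3 * Q / 4) ^ Q := by
  have hQ' : (0 : ℝ) < Q := by exact_mod_cast hQ
  rw [← mul_pow, show 2 * Real.exp 1 / Q * (D + 3 * Q / 4) =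
    Real.exp 1 / Q * (2 * D + 3 * Q / 2) by ring, mul_pow, div_pow,
    div_eq_mul_one_div, mul_comm]
  refine mul_le_mul_of_nonneg_right ?_ (by positivity)
  rw [div_le_div_iff₀ (by positivity) (by positivity), one_mul]
  exact pow_le_exp_pow_mul_factorial Q

lemma entropy_le_upperB_bound (hr : ∀ j, 0 < r j) (hQ : 0 < Q) (hτ : 1 ≤ τ)
    (hτQ : τ ≤ (Q : ℝ) / (2 * Real.exp (3 / 2) * Real.pi)) {ε : ℝ} (hε : 0 < ε)
    (hεle : ε ≤ (2 * Real.pi * Real.exp 1 * τ / Q) ^ ((Q : ℝ) / 2) *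
        (4 / (√(Real.exp 1 * τ) * Real.exp (Real.exp 2 * τ)))) :
    entropy ε (entireClass τ r) ≤
        2 / (3 * √(2 * Real.pi)) * (2 * Real.exp 1 / Q) ^ Q *
          (quotD τ (upperB Q τ ε) + 3 * Q / 4) ^ (Q + 1) *
          (5 * Real.log (Real.log (1 / ε)) +
            Real.log (((Q : ℝ) + 1) ^ 2 * (Real.exp 1 * τ) ^ 6)) := by
  have hτ0 : 0 < τ := by linarith
  have hQ' : (0 : ℝ) < Q := by exact_mod_cast hQ
  obtain ⟨h28, hhalf⟩ := bounds_of_le_div hQ hτ0 hτQ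
  have hQ28 : (28 : ℝ) ≤ Q := by linarith
  have hπ := Real.pi_pos
  have hε_log := log_eq_of_upperB hQ hτ0 hε
  have hlτ : 0 ≤ Real.log τ := Real.log_nonneg hτ
  have hB : Real.exp 2 * τ ≤ upperB Q τ ε := by
    have h := Real.log_le_log hε hεle
    have h1 : 2 * Real.pi * Real.exp 1 * τ / Q = (2 * Real.pi / Q) * (Real.exp 1 * τ) := by ring
    rw [Real.log_mul (by positivity) (by positivity), h1, Real.log_rpow (by positivity),
      Real.log_mul (show 2 * Real.pi / (Q : ℝ) ≠ 0 by positivity) (by positivity),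
      Real.log_div (show (4 : ℝ) ≠ 0 by norm_num) (by positivity),
      Real.log_mul (show √(Real.exp 1 * τ) ≠ 0 by positivity) (by positivity), Real.log_sqrt (by positivity), Real.log_exp, Real.log_mul (by positivity) hτ0.ne',
      Real.log_exp] at h
    linarith
  have hmain := entropy_le_quotD_upperB hr (by
    have : (6 : ℝ) ≤ Q := by linarith
    exact_mod_cast this) hτ hε hB
  have hly := one_le_log_of_le hτ0 hB
  set B := upperB Q τ ε with hBdef
  set D := quotD τ B with hDdef
  have he2 : (5 : ℝ) ≤ Real.exp 2 := by
    have h1 := Real.exp_one_gt_d9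
    have : Real.exp 2 = Real.exp 1 * Real.exp 1 := by rw [← Real.exp_add]; norm_num
    nlinarith
  have hB5 : 5 ≤ B := by nlinarith
  have hB0 : 0 < B := by linarith
  set L := Real.log (1 / ε) with hL
  have hLε : L = -Real.log ε := by rw [hL, one_div, Real.log_inv]
  have hlog2 := Real.log_two_lt_d9
  have hlog4 : Real.log 4 ≤ 1.4 := by
    rw [show (4 : ℝ) = 2 ^ 2 by norm_num, Real.log_pow]; push_cast; linarith
  have hLB : B + Q / 4 - 1.4 ≤ L := by
    have := mul_le_mul_of_nonneg_left hhalf (show (0 : ℝ) ≤ Q / 2 by positivity)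
    rw [hLε, hε_log]
    linarith
  have hL0 : 10 ≤ L := by linarith
  have hDy : D * Real.log (B / (Real.exp 1 * τ)) = B := by
    rw [hDdef, quotD_eq hτ0 hB0, div_mul_cancel₀ _ (by linarith)]
  have hD0 : 0 < D := by
    rw [hDdef, quotD_eq hτ0 hB0]; exact div_pos hB0 (by linarith)
  have hDB : D ≤ B := by nlinarith
  have he1 := Real.exp_one_gt_d9
  have hLL : Real.log (B / (Real.exp 1 * τ)) ≤ Real.log L := by
    refine Real.log_le_log (by positivity) (le_trans (div_le_self hB0.le ?_) (by linarith))
    nlinarith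
  have hBLL : B ≤ D * Real.log L := by
    rw [← hDy]; gcongr
  have hMLL : Real.log (2 * D + Q / 2) - 1 ≤ Real.log L := by
    have h1 : 2 * D + Q / 2 ≤ L * Real.exp 1 := by nlinarith
    have h2 := Real.log_le_log (by positivity) h1
    rw [Real.log_mul (by linarith) (by positivity), Real.log_exp] at h2
    linarith
  have hLL0 : 1 ≤ Real.log L := hly.trans hLL
  have hextra := twelve_le_log hQ28 hτ
  have hsqrt := le_two_div_three_mul_sqrt
  have hfac := pow_div_factorial_le hQ hD0.le
  set P := (2 * Real.exp 1 / Q) ^ Q * (D + 3 * Q / 4) ^ Q with hP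
  have hP0 : 0 ≤ P := by positivity
  refine hmain.trans ?_
  have hX : B + τ + (Q : ℝ) / 2 * (Real.log (2 * D + (Q : ℝ) / 2) - 1) +
      (1 + 3 * Q / 2 + (2 * D + (Q : ℝ) / 2)) * Real.log 2 ≤
      0.265 * ((D + 3 * Q / 4) * (5 * Real.log L + 12)) := by
    have h1 : (Q : ℝ) / 2 * (Real.log (2 * D + (Q : ℝ) / 2) - 1) ≤ Q / 2 * Real.log L := by gcongr
    have h2 : (1 + 3 * Q / 2 + (2 * D + (Q : ℝ) / 2)) * Real.log 2 ≤
        (1 + 3 * Q / 2 + (2 * D + (Q : ℝ) / 2)) * 0.7 := by gcongr; linarith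
    have h3 : 0 ≤ D * Real.log L := by positivity
    have h4 : 0 ≤ Q * Real.log L := by positivity
    linarith
  calc _ ≤ P * (B + τ + (Q : ℝ) / 2 * (Real.log (2 * D + (Q : ℝ) / 2) - 1) +
      (1 + 3 * Q / 2 + (2 * D + (Q : ℝ) / 2)) * Real.log 2) := by
        refine mul_le_mul_of_nonneg_right hfac ?_
        have h0 : 1 ≤ Real.log (2 * D + (Q : ℝ) / 2) := by
          rw [Real.le_log_iff_exp_le (by positivity)]
          linarith [Real.exp_one_lt_d9]
        have h1 : 0 ≤ (Q : ℝ) / 2 * (Real.log (2 * D + (Q : ℝ) / 2) - 1) :=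
          mul_nonneg (by positivity) (by linarith)
        have h2 : 0 ≤ (1 + 3 * Q / 2 + (2 * D + (Q : ℝ) / 2)) * Real.log 2 :=
          mul_nonneg (by positivity) (Real.log_nonneg (by norm_num))
        linarith
    _ ≤ P * (2 / (3 * √(2 * Real.pi)) * ((D + 3 * Q / 4) * (5 * Real.log L +
          Real.log (((Q : ℝ) + 1) ^ 2 * (Real.exp 1 * τ) ^ 6)))) := by
        refine mul_le_mul_of_nonneg_left (hX.trans ?_) hP0
        gcongr
    _ = _ := by rw [hP, pow_succ]; ring

/-! ### The explicit lower estimate -/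

lemma log_eq_of_lowerB (hτ : 0 < τ) {ε : ℝ} (hε : 0 < ε) :
    Real.log ε = (Q : ℝ) / 2 * Real.log (2 * Real.pi / Q) -
      Real.log (4 * √(2 * Real.pi * Real.exp 1 * τ)) - lowerB Q τ ε := by
  have := Real.pi_pos
  rw [lowerB, one_div, Real.log_inv, Real.log_mul (by positivity) hε.ne']
  ring

/-- A lower bound for the number of grid values, at step `3ε`, available to each coefficient of
degree `N ≥ 1`; it uses `N! ≤ N ^ N` and `2 ^ (N + Q)` as bound for the dimension. -/
lemma exp_le_radius_div (hQ : 0 < Q) (hτ : 0 < τ) {ε : ℝ} (hε : 0 < ε) {N : ℕ} (hN : 0 < N) :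
    Real.exp ((Q : ℝ) / 2 * Real.log (2 * Real.pi / Q) + (Q : ℝ) / 2 * (Real.log N - 3 * Real.log 2)
      + N * (Real.log τ - Real.log N - Real.log 2) - Real.log 3 - Real.log ε) ≤
      radius Q τ N / (3 * ε * √2 ^ Q * Q.multichoose N) := by
  have hd0 : (0 : ℝ) < Q.multichoose N := by
    rw [Nat.multichoose_eq]
    exact_mod_cast Nat.choose_pos (by omega)
  have hd : (Q.multichoose N : ℝ) ≤ Real.exp ((N + Q) * Real.log 2) := by
    have h1 : (Q.multichoose N : ℝ) ≤ 2 ^ (N + Q) := by exact_mod_cast multichoose_le_two_pow Q N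
    refine h1.trans (le_of_eq ?_)
    rw [← Real.exp_log (show (0 : ℝ) < 2 ^ (N + Q) by positivity), Real.log_pow]
    push_cast
    rfl
  have hsq : √2 ^ Q = Real.exp ((Q : ℝ) / 2 * Real.log 2) := by
    rw [← Real.exp_log (show (0 : ℝ) < √2 ^ Q by positivity), Real.log_pow,
      Real.log_sqrt (by norm_num)]
    ring_nf
  have h3 : (3 : ℝ) = Real.exp (Real.log 3) := (Real.exp_log (by norm_num)).symm
  have hεe : ε = Real.exp (Real.log ε) := (Real.exp_log hε).symm
  rw [le_div_iff₀ (by positivity)]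
  calc _ ≤ Real.exp ((Q : ℝ) / 2 * Real.log (2 * Real.pi / Q) +
        (Q : ℝ) / 2 * (Real.log N - 3 * Real.log 2)
        + N * (Real.log τ - Real.log N - Real.log 2) - Real.log 3 - Real.log ε) *
        (3 * ε * √2 ^ Q * Real.exp ((N + Q) * Real.log 2)) := by gcongr
    _ = Real.exp (((Q : ℝ) / 2 * Real.log (2 * Real.pi / Q) +
        (Q : ℝ) / 2 * (Real.log N - 3 * Real.log 2)
        + N * (Real.log τ - Real.log N - Real.log 2) - Real.log 3 - Real.log ε) +
        (Real.log 3 + Real.log ε + (Q : ℝ) / 2 * Real.log 2 + (N + Q) * Real.log 2)) := by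
      rw [Real.exp_add _ (Real.log 3 + _ + _ + _), Real.exp_add (Real.log 3 + _ + _),
        Real.exp_add (Real.log 3 + _), Real.exp_add (Real.log 3), ← h3, ← hεe, hsq]
    _ ≤ radius Q τ N := by
      rw [radius_eq_exp hQ hτ hN, Real.exp_le_exp]
      have := log_factorial_le_mul_log N
      linarith

lemma log_one_twenty_eight : Real.log 128 = 7 * Real.log 2 := by
  rw [show (128 : ℝ) = 2 ^ 7 by norm_num, Real.log_pow]; norm_num

lemma xi_bounds (hτ : 1 ≤ τ) : 600 * τ ≤ xi τ ∧ 8 ≤ Real.log (xi τ) := by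
  have he1 := Real.exp_one_gt_d9
  have he1' := Real.exp_one_lt_d9
  set a := max (3 * Real.exp 2 * τ) 128 with ha
  have ha1 : 128 ≤ a := le_max_right _ _
  have hla : 4.85 ≤ Real.log a := by
    have := Real.log_le_log (by norm_num) ha1
    rw [log_one_twenty_eight] at this
    linarith [Real.log_two_gt_d9]
  have he2 : (7.38 : ℝ) ≤ Real.exp 2 := by
    have : Real.exp 2 = Real.exp 1 * Real.exp 1 := by rw [← Real.exp_add]; norm_num
    nlinarith
  have ha2 : 22 * τ ≤ a := by
    refine le_trans ?_ (le_max_left _ _)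
    nlinarith
  have hxi : 28 * a ≤ xi τ := by
    have : 28 * a ≤ 16 * a * Real.log a / Real.exp 1 := by
      rw [le_div_iff₀ (by positivity)]
      nlinarith
    rw [xi, ← ha]
    linarith
  refine ⟨by linarith, ?_⟩
  rw [Real.le_log_iff_exp_le (by linarith)]
  have h8 : Real.exp 8 = Real.exp 1 ^ 8 := by rw [← Real.exp_nat_mul]; norm_num
  have h9 : Real.exp 1 ^ 8 ≤ 2.7183 ^ 8 := by gcongr; linarith
  rw [h8]
  have : (2.7183 : ℝ) ^ 8 ≤ 3000 := by norm_num
  linarith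

/-- In the range `N ≤ D(B₋)` there are at least `exp ((N - 7) / 4)` grid values for each
coefficient of degree `N`. -/
lemma exp_le_max_of_lowerB (hQ : 0 < Q) (hτ : 1 ≤ τ) {ε : ℝ} (hε : 0 < ε)
    (hB0 : 0 < lowerB Q τ ε) (hly : 8 ≤ Real.log (lowerB Q τ ε / (Real.exp 1 * τ))) {N : ℕ}
    (hND : (N : ℝ) ≤ quotD τ (lowerB Q τ ε)) :
    Real.exp (((N : ℝ) - 7) / 4) ≤
      max 1 (radius Q τ N / (3 * ε * √2 ^ Q * Q.multichoose N)) := by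
  have hτ0 : 0 < τ := by linarith
  have hπ := Real.pi_pos
  have hlog2 := Real.log_two_gt_d9
  have hlog2' := Real.log_two_lt_d9
  have hε_log := log_eq_of_lowerB (Q := Q) hτ0 hε
  set B := lowerB Q τ ε with hBdef
  set y := B / (Real.exp 1 * τ) with hy
  set D := quotD τ B with hDdef
  have hDy : D * Real.log y = B := by
    rw [hDdef, quotD_eq hτ0 hB0, div_mul_cancel₀ _ (by linarith)]
  have hBD : Real.log B = Real.log y + 1 + Real.log τ := by
    rw [hy, Real.log_div hB0.ne' (by positivity), Real.log_mul (by positivity) hτ0.ne',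
      Real.log_exp]
    ring
  have h4s : Real.log 3 ≤ Real.log (4 * √(2 * Real.pi * Real.exp 1 * τ)) := by
    refine Real.log_le_log (by norm_num) ?_
    have : 1 ≤ √(2 * Real.pi * Real.exp 1 * τ) := by
      rw [Real.one_le_sqrt]
      have h3 := Real.pi_gt_three
      have he : 1 ≤ Real.exp 1 := by linarith [Real.add_one_le_exp (1 : ℝ)]
      exact one_le_mul_of_one_le_of_one_le
        (one_le_mul_of_one_le_of_one_le (by linarith) he) hτ
    linarith
  rcases Nat.lt_or_ge N 8 with h8 | h8
  · refine le_max_of_le_left (Real.exp_le_one_iff.2 ?_)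
    have : (N : ℝ) ≤ 7 := by exact_mod_cast Nat.lt_succ_iff.1 h8
    linarith
  · refine le_max_of_le_right (le_trans ?_ (exp_le_radius_div hQ hτ0 hε (by omega)))
    rw [Real.exp_le_exp, hε_log]
    have hN8 : (8 : ℝ) ≤ N := by exact_mod_cast h8
    have hN0 : (0 : ℝ) < N := by linarith
    have hlN : 3 * Real.log 2 ≤ Real.log N := by
      have := Real.log_le_log (by norm_num) hN8
      rwa [show (8 : ℝ) = 2 ^ 3 by norm_num, Real.log_pow] at this
    have hQN : 0 ≤ (Q : ℝ) / 2 * (Real.log N - 3 * Real.log 2) :=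
      mul_nonneg (by positivity) (by linarith)
    -- `B / N ≥ B / D = log y` controls both the linear and the logarithmic term
    have hBN : Real.log y ≤ B / N := by
      rw [le_div_iff₀ hN0, ← hDy, mul_comm]
      gcongr
    have hloglog : 3 * Real.log 2 ≤ Real.log B - Real.log N := by
      rw [← Real.log_div hB0.ne' hN0.ne']
      have : Real.log 8 ≤ Real.log (B / N) := Real.log_le_log (by norm_num) (by linarith)
      rwa [show (8 : ℝ) = 2 ^ 3 by norm_num, Real.log_pow] at this
    have hBN' : N * Real.log y ≤ B := by
      rw [le_div_iff₀ hN0] at hBN; linarith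
    have hfin : (N : ℝ) * (1 / 4) ≤
        N * (Real.log y + (Real.log τ - Real.log N - Real.log 2)) := by
      gcongr
      linarith
    nlinarith

/-- The average degree of a multi-index of degree at most `n` is `n Q / (Q + 1) ≥ n / 2`. -/
lemma le_sum_multichoose_mul (hQ : 0 < Q) (n : ℕ) :
    (n : ℝ) * (n + Q).choose Q / 8 - 7 / 4 * (n + Q).choose Q ≤
      ∑ N ∈ Finset.range (n + 1), (Q.multichoose N : ℝ) * (((N : ℝ) - 7) / 4) := by
  have hQ1 : (1 : ℝ) ≤ Q := by exact_mod_cast hQ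
  have h1 : (∑ N ∈ Finset.range (n + 1), (Q.multichoose N : ℝ)) = (n + Q).choose Q := by
    exact_mod_cast sum_multichoose Q n
  have h2 : ((Q : ℝ) + 1) * ∑ N ∈ Finset.range (n + 1), ((N : ℝ) * Q.multichoose N) =
      Q * n * (n + Q).choose Q := by
    exact_mod_cast sum_mul_multichoose Q n
  have h3 : ∑ N ∈ Finset.range (n + 1), (Q.multichoose N : ℝ) * (((N : ℝ) - 7) / 4) =
      (∑ N ∈ Finset.range (n + 1), ((N : ℝ) * Q.multichoose N)) / 4 -
        7 / 4 * (n + Q).choose Q := by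
    rw [← h1, Finset.sum_div, Finset.mul_sum, ← Finset.sum_sub_distrib]
    exact Finset.sum_congr rfl fun N _ => by ring
  rw [h3]
  set C := ((n + Q).choose Q : ℝ) with hC
  have hC0 : 0 < C := by
    rw [hC]; exact_mod_cast Nat.choose_pos (Nat.le_add_left Q n)
  have h4 : (n : ℝ) * C / 2 ≤ ∑ N ∈ Finset.range (n + 1), ((N : ℝ) * Q.multichoose N) := by
    set S := ∑ N ∈ Finset.range (n + 1), ((N : ℝ) * Q.multichoose N)
    have hnC : 0 ≤ (n : ℝ) * C := by positivity
    have : ((Q : ℝ) + 1) * ((n : ℝ) * C / 2) ≤ (Q + 1) * S := by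
      rw [h2]; nlinarith
    exact le_of_mul_le_mul_left this (by positivity)
  linarith

lemma pow_le_choose_of_le (hQ : 0 < Q) (n : ℕ) {x : ℝ} (hx : 0 ≤ x) (hxn : x ≤ n + Q) :
    (1 / (Q : ℝ)) ^ Q * x ^ Q ≤ (n + Q).choose Q := by
  have hQ' : (0 : ℝ) < Q := by exact_mod_cast hQ
  have h6 : ((n : ℝ) + Q) ^ Q ≤ (n + Q).choose Q * Q ^ Q := by
    exact_mod_cast add_pow_le_choose_mul_pow n Q
  calc (1 / (Q : ℝ)) ^ Q * x ^ Q ≤ (1 / (Q : ℝ)) ^ Q * ((n : ℝ) + Q) ^ Q := by gcongr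
    _ ≤ (1 / (Q : ℝ)) ^ Q * ((n + Q).choose Q * Q ^ Q) := by gcongr
    _ = (n + Q).choose Q := by rw [one_div, inv_pow]; field_simp

lemma lowerB_bound_le_entropy (hr : ∀ j, 0 < r j) (hQ : 0 < Q) (hτ : 1 ≤ τ) {ε : ℝ} (hε : 0 < ε)
    (hεle : ε ≤ (2 * Real.pi / Q) ^ ((Q : ℝ) / 2) *
        (1 / (4 * √(2 * Real.pi * Real.exp 1 * τ))) * xi τ ^ (-2 * xi τ)) :
    1 / (16 * √(Real.pi * Q)) * (1 / (Q : ℝ)) ^ Q *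
          (quotD τ (lowerB Q τ ε) - 5 / 2 + Q) ^ Q * (quotD τ (lowerB Q τ ε) - 3 / 2) ≤
        entropy ε (entireClass τ r) := by
  have hτ0 : 0 < τ := by linarith
  have hQ' : (0 : ℝ) < Q := by exact_mod_cast hQ
  have hQ1 : (1 : ℝ) ≤ Q := by exact_mod_cast hQ
  have hπ := Real.pi_pos
  have hlτ : 0 ≤ Real.log τ := Real.log_nonneg hτ
  have he1 := Real.exp_one_gt_d9
  have he1' := Real.exp_one_lt_d9
  have hlog2 := Real.log_two_gt_d9
  have hlog2' := Real.log_two_lt_d9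
  obtain ⟨hxi, hlxi⟩ := xi_bounds hτ
  have hxi0 : 0 < xi τ := by linarith
  have hε_log := log_eq_of_lowerB (Q := Q) hτ0 hε
  set B := lowerB Q τ ε with hBdef
  have hB : 9600 * τ ≤ B := by
    have h := Real.log_le_log hε hεle
    rw [Real.log_mul (by positivity) (by positivity), Real.log_mul (by positivity) (by positivity),
      Real.log_rpow (by positivity), Real.log_rpow hxi0, one_div, Real.log_inv, hε_log] at h
    nlinarith
  have hB0 : 0 < B := by linarith
  set y := B / (Real.exp 1 * τ) with hy
  have hy3 : 3000 ≤ y := by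
    rw [hy, le_div_iff₀ (by positivity)]
    nlinarith
  have hy0 : 0 < y := by linarith
  have hly : 8 ≤ Real.log y := by
    rw [Real.le_log_iff_exp_le hy0]
    have h8 : Real.exp 8 = Real.exp 1 ^ 8 := by rw [← Real.exp_nat_mul]; norm_num
    have h9 : Real.exp 1 ^ 8 ≤ 2.7183 ^ 8 := by gcongr; linarith
    rw [h8]
    have : (2.7183 : ℝ) ^ 8 ≤ 3000 := by norm_num
    linarith
  set D := quotD τ B with hDdef
  have hDy : D * Real.log y = B := by
    rw [hDdef, quotD_eq hτ0 hB0, div_mul_cancel₀ _ (by linarith)]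
  have hD0 : 0 < D := by
    rw [hDdef, quotD_eq hτ0 hB0]; exact div_pos hB0 (by linarith)
  have hD30 : 30 ≤ D := by
    have hs := log_le_two_sqrt_div_exp hy0
    rw [le_div_iff₀ (by positivity)] at hs
    have hsy : 50 ≤ √y := Real.le_sqrt_of_sq_le (by linarith)
    have hyB : y ≤ B := div_le_self hB0.le (by nlinarith)
    have hss := Real.mul_self_sqrt hy0.le
    by_contra! hlt
    have h1 : y ≤ D * Real.log y := by rw [hDy]; exact hyB
    nlinarith
  set n := ⌊D⌋₊ with hn
  have hnD : (n : ℝ) ≤ D := Nat.floor_le hD0.le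
  have hDn : D - 1 ≤ n := by linarith [Nat.lt_floor_add_one D]
  have hg : ∀ N ≤ n, Real.exp (((N : ℝ) - 7) / 4) ≤
      max 1 (radius Q τ N / (3 * ε * √2 ^ Q * Q.multichoose N)) := fun N hN =>
    exp_le_max_of_lowerB hQ hτ hε hB0 hly (le_trans (by exact_mod_cast hN) hnD)
  have hsum := le_entropy hr hτ0.le hε n (fun N => ((N : ℝ) - 7) / 4) hg
  refine le_trans ?_ hsum
  refine le_trans ?_ (le_sum_multichoose_mul hQ n)
  have h5 := pow_le_choose_of_le hQ n (x := D - 5 / 2 + Q) (by linarith) (by linarith)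
  set C := ((n + Q).choose Q : ℝ) with hC
  have hC0 : 0 < C := by
    rw [hC]; exact_mod_cast Nat.choose_pos (Nat.le_add_left Q n)
  have h7 : 1 / (16 * √(Real.pi * Q)) ≤ 1 / 16 := by
    have : 1 ≤ √(Real.pi * Q) := by
      rw [Real.one_le_sqrt]
      nlinarith [Real.pi_gt_three]
    exact one_div_le_one_div_of_le (by norm_num) (by linarith)
  calc _ = 1 / (16 * √(Real.pi * Q)) * ((1 / (Q : ℝ)) ^ Q * (D - 5 / 2 + Q) ^ Q) *
        (D - 3 / 2) := by ring
    _ ≤ 1 / 16 * C * (D - 3 / 2) := by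
        refine mul_le_mul_of_nonneg_right (mul_le_mul h7 h5 ?_ (by norm_num)) (by linarith)
        exact mul_nonneg (by positivity) (pow_nonneg (by linarith) Q)
    _ ≤ n * C / 8 - 7 / 4 * C := by nlinarith

/-! ### Asymptotics as `ε → 0` -/

lemma tendsto_log_div_self : Tendsto (fun t : ℝ => Real.log t / t) atTop (𝓝 0) :=
  Real.isLittleO_log_id_atTop.tendsto_div_nhds_zero

lemma tendsto_quotD_mul_log_div (τ c : ℝ) :
    Tendsto (fun t : ℝ => quotD τ (t + c) * Real.log t / t) atTop (𝓝 1) := by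
  set k := Real.log (Real.exp 1 * τ)
  have h1 : Tendsto (fun t : ℝ => (t + c) / t) atTop (𝓝 1) := by
    have h := (tendsto_const_nhds (x := c)).div_atTop (tendsto_id (α := ℝ) (x := atTop))
    have h2 := h.const_add 1
    rw [add_zero] at h2
    refine h2.congr' ?_
    filter_upwards [eventually_gt_atTop 0] with t ht
    simp only [id]
    field_simp
  have h2 : Tendsto (fun t : ℝ => (Real.log (t + c) - k) / Real.log t) atTop (𝓝 1) := by
    have h := ((Real.tendsto_log_comp_add_sub_log c).sub_const k).div_atTop Real.tendsto_log_atTop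
    have h2 := h.const_add 1
    rw [add_zero] at h2
    refine h2.congr' ?_
    filter_upwards [Real.tendsto_log_atTop.eventually_gt_atTop 0] with t ht
    field_simp
    ring
  have h3 := h1.div h2 one_ne_zero
  rw [div_one] at h3
  refine h3.congr fun t => ?_
  simp only [Pi.div_apply, quotD]
  rw [div_div_div_eq, div_mul_eq_mul_div, div_div, mul_comm t]

/-- For large `log (1 / ε)` the explicit upper estimate is at most `2 ^ Q (1 + o(1))` times
`L ^ (Q + 1) / (Q! (log L) ^ Q)`, `L = log (1 / ε)`, which leaves a factor `2` to spare. -/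
lemma eventually_upper_le (hτ : 1 ≤ τ) (Q : ℕ) (c : ℝ) :
    ∀ᶠ t : ℝ in atTop, Real.exp 2 * τ ≤ t + c ∧
      (2 * quotD τ (t + c) + 3 * Q / 2) ^ Q / Q.factorial *
        (t + c + τ + (Q : ℝ) / 2 * (Real.log (2 * quotD τ (t + c) + (Q : ℝ) / 2) - 1) +
          (1 + 3 * Q / 2 + (2 * quotD τ (t + c) + (Q : ℝ) / 2)) * Real.log 2) ≤
      1 / Q.factorial * ((2 * t) ^ (Q + 1) / Real.log t ^ Q) := by
  have hτ0 : 0 < τ := by linarith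
  set D : ℝ → ℝ := fun t => quotD τ (t + c) with hD
  have h1 : Tendsto (fun t => D t * Real.log t / t) atTop (𝓝 1) := tendsto_quotD_mul_log_div τ c
  have h2 : Tendsto (fun t => D t / t) atTop (𝓝 0) := by
    refine (h1.div_atTop Real.tendsto_log_atTop).congr' ?_
    filter_upwards [Real.tendsto_log_atTop.eventually_gt_atTop 0] with t ht
    rw [mul_div_right_comm, mul_div_cancel_right₀ _ ht.ne']
  have hinv : Tendsto (fun t : ℝ => t⁻¹) atTop (𝓝 0) := tendsto_inv_atTop_zero
  set K := c + τ + (Q : ℝ) / 2 * ((Q : ℝ) / 2) +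
    (1 + 3 * Q / 2 + (Q : ℝ) / 2) * Real.log 2 with hK
  have h3 : Tendsto (fun t => 1 + K * t⁻¹ + (Q + 2 * Real.log 2) * (D t / t)) atTop (𝓝 1) := by
    simpa using ((hinv.const_mul K).const_add 1).add (h2.const_mul (Q + 2 * Real.log 2))
  have h4 : Tendsto (fun t => 2 * (D t * Real.log t / t) + 3 * Q / 2 * (Real.log t / t))
      atTop (𝓝 2) := by
    simpa using (h1.const_mul 2).add (tendsto_log_div_self.const_mul (3 * (Q : ℝ) / 2))
  have h5 := (h4.pow Q).mul h3
  have hlt : (2 : ℝ) ^ Q * 1 < 2 ^ (Q + 1) := by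
    rw [pow_succ]; have : (0 : ℝ) < 2 ^ Q := by positivity
    linarith
  filter_upwards [h5.eventually_le_const hlt, eventually_ge_atTop (Real.exp 2 * τ - c),
    eventually_gt_atTop 0, Real.tendsto_log_atTop.eventually_gt_atTop 0] with t ht htB ht0 hlt0
  have hB : Real.exp 2 * τ ≤ t + c := by linarith
  refine ⟨hB, ?_⟩
  have hly := one_le_log_of_le hτ0 hB
  have hB0 : 0 < t + c := lt_of_lt_of_le (by positivity) hB
  have hD0 : 0 < D t := by
    simp only [hD]
    rw [quotD_eq hτ0 hB0]; exact div_pos hB0 (by linarith)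
  change (2 * D t + 3 * Q / 2) ^ Q / Q.factorial *
        (t + c + τ + (Q : ℝ) / 2 * (Real.log (2 * D t + (Q : ℝ) / 2) - 1) +
          (1 + 3 * Q / 2 + (2 * D t + (Q : ℝ) / 2)) * Real.log 2) ≤ _
  have hX : t + c + τ + (Q : ℝ) / 2 * (Real.log (2 * D t + (Q : ℝ) / 2) - 1) +
      (1 + 3 * Q / 2 + (2 * D t + (Q : ℝ) / 2)) * Real.log 2 ≤
      t * (1 + K * t⁻¹ + (Q + 2 * Real.log 2) * (D t / t)) := by
    have hl : Real.log (2 * D t + (Q : ℝ) / 2) - 1 ≤ 2 * D t + (Q : ℝ) / 2 := by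
      linarith [Real.log_le_sub_one_of_pos (x := 2 * D t + (Q : ℝ) / 2) (by positivity)]
    have hl2 := mul_le_mul_of_nonneg_left hl (show (0 : ℝ) ≤ Q / 2 by positivity)
    have he : t * (1 + K * t⁻¹ + (Q + 2 * Real.log 2) * (D t / t)) =
        t + K + (Q + 2 * Real.log 2) * D t := by field_simp
    rw [he, hK]
    linarith
  have ha : 2 * (D t * Real.log t / t) + 3 * Q / 2 * (Real.log t / t) =
      (2 * D t + 3 * Q / 2) * (Real.log t / t) := by ring
  rw [ha, mul_pow] at ht
  calc _ ≤ (2 * D t + 3 * Q / 2) ^ Q / Q.factorial *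
        (t * (1 + K * t⁻¹ + (Q + 2 * Real.log 2) * (D t / t))) := by gcongr
    _ = 1 / Q.factorial * (t ^ (Q + 1) / Real.log t ^ Q) *
        ((2 * D t + 3 * Q / 2) ^ Q * (Real.log t / t) ^ Q *
          (1 + K * t⁻¹ + (Q + 2 * Real.log 2) * (D t / t))) := by
        rw [div_pow, pow_succ]; field_simp
    _ ≤ 1 / Q.factorial * (t ^ (Q + 1) / Real.log t ^ Q) * 2 ^ (Q + 1) := by gcongr
    _ = _ := by rw [mul_pow]; ring

/-- The truncation degree `m = ⌊0.6 L / log L⌋` for the asymptotic lower bound. It exceeds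
`L / (2 log L)` by the factor `1.2`, and `1.2 ^ Q ≥ 8` pays for all constants. -/
lemma eventually_lower_le (hQ : 12 ≤ Q) (c : ℝ) :
    ∀ᶠ t : ℝ in atTop, ∃ m : ℕ, 0 ≤ t ∧
      (m : ℝ) * Real.log (2 * m) ≤ c + t - t / 3 ∧
      1 / (2 * (Q.factorial : ℝ)) * (t ^ (Q + 1) / (2 * Real.log t) ^ Q) *
        (1 + Q * Real.log t / t) ≤ t / 3 * ((m + Q).choose Q - 1) := by
  have hu : Tendsto (fun t : ℝ => t / (2 * Real.log t)) atTop atTop := by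
    have h : Tendsto (fun t : ℝ => 2 * (Real.log t / t)) atTop (𝓝[>] 0) := by
      refine tendsto_nhdsWithin_iff.2 ⟨by simpa using tendsto_log_div_self.const_mul 2, ?_⟩
      filter_upwards [eventually_gt_atTop 1] with t ht
      exact mul_pos two_pos (div_pos (Real.log_pos ht) (by linarith))
    refine h.inv_tendsto_nhdsGT_zero.congr fun t => ?_
    simp only [Pi.inv_apply]
    rw [← mul_div_assoc, inv_div]
  have hA := (tendsto_pow_atTop (show Q ≠ 0 by omega)).comp hu
  have hδ : Tendsto (fun t : ℝ => Q * (Real.log t / t)) atTop (𝓝 0) := by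
    simpa using tendsto_log_div_self.const_mul (Q : ℝ)
  filter_upwards [eventually_gt_atTop 0, Real.tendsto_log_atTop.eventually_ge_atTop 2,
    hA.eventually_ge_atTop (Q.factorial : ℝ), hδ.eventually_le_const zero_lt_one,
    eventually_ge_atTop (-15 * c)] with t ht hlt hAt hδt htc
  simp only [Function.comp_apply] at hAt
  have hlt0 : 0 < Real.log t := by linarith
  set u := t / (2 * Real.log t) with hudef
  have hu0 : 0 < u := by positivity
  have hul : u * Real.log t = t / 2 := by rw [hudef]; field_simp
  refine ⟨⌊1.2 * u⌋₊, ht.le, ?_, ?_⟩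
  · have hm : (⌊1.2 * u⌋₊ : ℝ) ≤ 1.2 * u := Nat.floor_le (by positivity)
    have hm0 : (0 : ℝ) ≤ ⌊1.2 * u⌋₊ := Nat.cast_nonneg _
    have hl : Real.log (2 * ⌊1.2 * u⌋₊) ≤ Real.log t := by
      rcases hm0.eq_or_lt with h0 | h0
      · rw [← h0, mul_zero, Real.log_zero]; exact hlt0.le
      · refine Real.log_le_log (by positivity) ?_
        nlinarith
    calc (⌊1.2 * u⌋₊ : ℝ) * Real.log (2 * ⌊1.2 * u⌋₊) ≤ ⌊1.2 * u⌋₊ * Real.log t := by gcongr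
      _ ≤ 1.2 * u * Real.log t := by gcongr
      _ ≤ _ := by rw [mul_assoc, hul]; linarith
  · set m := ⌊1.2 * u⌋₊
    have hf : (0 : ℝ) < Q.factorial := by positivity
    have hm1 : 1.2 * u ≤ m + 1 := (Nat.lt_floor_add_one _).le
    have hC : ((m : ℝ) + 1) ^ Q ≤ Q.factorial * (m + Q).choose Q := by
      have := Nat.pow_le_choose (α := ℝ) Q (m + Q)
      rw [show m + Q + 1 - Q = m + 1 by omega] at this
      rw [div_le_iff₀ hf] at this
      push_cast at this
      linarith
    have h12 : (8 : ℝ) ≤ 1.2 ^ Q := by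
      calc (8 : ℝ) ≤ 1.2 ^ 12 := by norm_num
        _ ≤ 1.2 ^ Q := pow_le_pow_right₀ (by norm_num) hQ
    set A := u ^ Q / Q.factorial with hAdef
    have hA1 : 1 ≤ A := by rw [hAdef, le_div_iff₀ hf, one_mul]; exact hAt
    have hCA : 8 * A ≤ (m + Q).choose Q := by
      rw [hAdef, mul_div_assoc', div_le_iff₀ hf]
      calc 8 * u ^ Q ≤ 1.2 ^ Q * u ^ Q := by gcongr
        _ = (1.2 * u) ^ Q := by rw [mul_pow]
        _ ≤ ((m : ℝ) + 1) ^ Q := by gcongr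
        _ ≤ _ := by linarith
    have hlhs : 1 / (2 * (Q.factorial : ℝ)) * (t ^ (Q + 1) / (2 * Real.log t) ^ Q) =
        1 / 2 * (t * A) := by
      rw [hAdef, hudef, div_pow, pow_succ]; field_simp
    rw [hlhs, mul_div_assoc]
    calc 1 / 2 * (t * A) * (1 + Q * (Real.log t / t)) ≤ 1 / 2 * (t * A) * (1 + 1) := by gcongr
      _ ≤ t / 3 * (8 * A - 1) := by nlinarith
      _ ≤ _ := by gcongr

lemma tendsto_log_one_div : Tendsto (fun ε : ℝ => Real.log (1 / ε)) (𝓝[>] 0) atTop := by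
  simp only [one_div]
  exact Real.tendsto_log_atTop.comp tendsto_inv_nhdsGT_zero

lemma eventually_entropy_le (hr : ∀ j, 0 < r j) (hQ : 6 ≤ Q) (hτ : 1 ≤ τ) :
    ∀ᶠ ε : ℝ in 𝓝[>] 0, entropy ε (entireClass τ r) ≤
      1 / (Q.factorial : ℝ) *
        ((2 * Real.log (1 / ε)) ^ (Q + 1) / Real.log (Real.log (1 / ε)) ^ Q) := by
  filter_upwards [tendsto_log_one_div.eventually (eventually_upper_le hτ Q (Real.log 4 +
    (Q : ℝ) / 2 * Real.log (2 * Real.exp 1 * Real.pi * τ / Q))), self_mem_nhdsWithin] with ε h hε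
  have hε0 : (0 : ℝ) < ε := hε
  have hB : upperB Q τ ε = Real.log (1 / ε) + (Real.log 4 +
      (Q : ℝ) / 2 * Real.log (2 * Real.exp 1 * Real.pi * τ / Q)) := by
    rw [upperB, Real.log_div (by norm_num) hε0.ne', one_div, Real.log_inv]
    ring
  rw [← hB] at h
  exact (entropy_le_quotD_upperB hr hQ hτ hε0 h.1).trans h.2

lemma eventually_le_entropy (hr : ∀ j, 0 < r j) (hQ : 12 ≤ Q) (hτ : 1 ≤ τ) :
    ∀ᶠ ε : ℝ in 𝓝[>] 0, 1 / (2 * (Q.factorial : ℝ)) *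
      (Real.log (1 / ε) ^ (Q + 1) / (2 * Real.log (Real.log (1 / ε))) ^ Q) *
        (1 + Q * Real.log (Real.log (1 / ε)) / Real.log (1 / ε)) ≤
      entropy ε (entireClass τ r) := by
  have hτ0 : 0 < τ := by linarith
  have hlτ : 0 ≤ Real.log τ := Real.log_nonneg hτ
  filter_upwards [tendsto_log_one_div.eventually (eventually_lower_le hQ
    ((Q : ℝ) / 2 * Real.log (2 * Real.pi / Q) - 3 * Q / 2 * Real.log 2 - Real.log 3)),
    self_mem_nhdsWithin] with ε ⟨m, ht0, hm, hle⟩ hε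
  have hε0 : (0 : ℝ) < ε := hε
  have hlog : Real.log (1 / ε) = -Real.log ε := by rw [one_div, Real.log_inv]
  set t := Real.log (1 / ε)
  refine hle.trans ?_
  have h := le_entropy hr hτ0.le hε0 m (fun N => if N = 0 then 0 else t / 3) fun N hN => ?_
  · refine le_trans (le_of_eq ?_) h
    have h1 : (∑ N ∈ Finset.range (m + 1), (Q.multichoose N : ℝ)) = (m + Q).choose Q := by
      exact_mod_cast sum_multichoose Q m
    rw [← h1, Finset.sum_range_succ', Finset.sum_range_succ']
    simp [Finset.mul_sum, mul_comm]
  · split_ifs with hN0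
    · rw [Real.exp_zero]; exact le_max_left _ _
    · refine le_max_of_le_right (le_trans ?_
        (exp_le_radius_div (by omega) hτ0 hε0 (Nat.pos_of_ne_zero hN0)))
      rw [Real.exp_le_exp]
      have hN1 : (1 : ℝ) ≤ N := by exact_mod_cast Nat.pos_of_ne_zero hN0
      have hNm : (N : ℝ) ≤ m := by exact_mod_cast hN
      have hlN : 0 ≤ Real.log N := Real.log_nonneg hN1
      have h2N : Real.log (2 * N) = Real.log 2 + Real.log N :=
        Real.log_mul (by norm_num) (by linarith)
      have h2 : (N : ℝ) * Real.log (2 * N) ≤ m * Real.log (2 * m) := by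
        have h3 : Real.log (2 * N) ≤ Real.log (2 * m) :=
          Real.log_le_log (by linarith) (by linarith)
        exact mul_le_mul hNm h3 (Real.log_nonneg (by linarith)) (by linarith)
      rw [h2N] at h2
      have h4 : 0 ≤ (N : ℝ) * Real.log τ := by positivity
      have h5 : 0 ≤ (Q : ℝ) / 2 * Real.log N := by positivity
      linarith

end EntireEntropy

theorem theorem3p3 (Q : ℕ) (τ : ℝ) (hτ₁ : 1 ≤ τ)
    (hτ₂ : τ ≤ (Q : ℝ) / (2 * Real.exp (3 / 2) * Real.pi))
    (r : Fin Q → ℝ) (hr : ∀ j, 0 < r j) :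
    -- the class is compact, so that its entropy is finite
    IsCompact (EntireEntropy.entireClass τ r) ∧
    -- upper bound
    (∀ ε : ℝ, 0 < ε →
      ε ≤ (2 * Real.pi * Real.exp 1 * τ / Q) ^ ((Q : ℝ) / 2) *
        (4 / (√(Real.exp 1 * τ) * Real.exp (Real.exp 2 * τ))) →
      EntireEntropy.entropy ε (EntireEntropy.entireClass τ r) ≤
        2 / (3 * √(2 * Real.pi)) * (2 * Real.exp 1 / Q) ^ Q *
          (EntireEntropy.quotD τ (EntireEntropy.upperB Q τ ε) + 3 * Q / 4) ^ (Q + 1) *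
          (5 * Real.log (Real.log (1 / ε)) +
            Real.log (((Q : ℝ) + 1) ^ 2 * (Real.exp 1 * τ) ^ 6))) ∧
    -- lower bound
    (∀ ε : ℝ, 0 < ε →
      ε ≤ (2 * Real.pi / Q) ^ ((Q : ℝ) / 2) *
        (1 / (4 * √(2 * Real.pi * Real.exp 1 * τ))) *
          EntireEntropy.xi τ ^ (-2 * EntireEntropy.xi τ) →
      1 / (16 * √(Real.pi * Q)) * (1 / (Q : ℝ)) ^ Q *
          (EntireEntropy.quotD τ (EntireEntropy.lowerB Q τ ε) - 5 / 2 + Q) ^ Q *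
          (EntireEntropy.quotD τ (EntireEntropy.lowerB Q τ ε) - 3 / 2) ≤
        EntireEntropy.entropy ε (EntireEntropy.entireClass τ r)) ∧
    -- asymptotics as `ε → 0+`, with the order of the `o(1)` terms
    (∃ δ₁ δ₂ : ℝ → ℝ,
      δ₁ ~[𝓝[>] 0] (fun ε : ℝ => Q * Real.log (Real.log (1 / ε)) / Real.log (1 / ε)) ∧
      δ₂ ~[𝓝[>] 0] (fun ε : ℝ => Q * Real.log (Real.log (1 / ε)) / Real.log (1 / ε)) ∧
      ∀ᶠ ε : ℝ in 𝓝[>] 0,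
        1 / (2 * (Q.factorial : ℝ)) *
            (Real.log (1 / ε) ^ (Q + 1) / (2 * Real.log (Real.log (1 / ε))) ^ Q) * (1 + δ₁ ε) ≤
          EntireEntropy.entropy ε (EntireEntropy.entireClass τ r) ∧
        EntireEntropy.entropy ε (EntireEntropy.entireClass τ r) ≤
          1 / (Q.factorial : ℝ) *
            ((2 * Real.log (1 / ε)) ^ (Q + 1) / Real.log (Real.log (1 / ε)) ^ Q) *
              (1 + δ₂ ε)) := by
  have hτ0 : 0 < τ := by linarith
  have hQ : 0 < Q := by
    rcases Nat.eq_zero_or_pos Q with rfl | h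
    · rw [Nat.cast_zero, zero_div] at hτ₂; linarith
    · exact h
  have hQ28 : 28 ≤ Q := by
    have := (EntireEntropy.bounds_of_le_div hQ hτ0 hτ₂).1
    exact_mod_cast (show (28 : ℝ) ≤ Q by linarith)
  refine ⟨EntireEntropy.isCompact_entireClass hr hτ0.le,
    fun ε hε hle => EntireEntropy.entropy_le_upperB_bound hr hQ hτ₁ hτ₂ hε hle,
    fun ε hε hle => EntireEntropy.lowerB_bound_le_entropy hr hQ hτ₁ hε hle,
    fun ε => Q * Real.log (Real.log (1 / ε)) / Real.log (1 / ε),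
    fun ε => Q * Real.log (Real.log (1 / ε)) / Real.log (1 / ε),
    IsEquivalent.refl, IsEquivalent.refl, ?_⟩
  filter_upwards [EntireEntropy.eventually_le_entropy hr (by omega) hτ₁,
    EntireEntropy.eventually_entropy_le hr (by omega) hτ₁,
    EntireEntropy.tendsto_log_one_div.eventually_gt_atTop 1] with ε h1 h2 h3
  refine ⟨h1, h2.trans (le_mul_of_one_le_right ?_ ?_)⟩
  · have := Real.log_pos h3
    positivity
  · have := Real.log_pos h3
    have : 0 ≤ Q * Real.log (Real.log (1 / ε)) / Real.log (1 / ε) := by positivity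
    linarith
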